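/- Let $0\le b<1$, $c>0$, $\tau\ge 0$. For bounded $g:\mathbb R\to\mathbb R$ put $(Sg)(t)=g(t-c\tau)$ and $(Bg)(t)=\sum_{j\ge 0}b^{j}g(t-jc\tau)$, and let $$\chi_0(z)=z^2-cz+\frac{1}{1-be^{-zc\tau}} .$$ Suppose that $\varphi\in C^2(\mathbb R)$ is a bounded, monotone, non-constant solution of the problem $$\varphi''(t)-c\varphi'(t)+(B\varphi)(t)\bigl(1-(1-b)(SB\varphi)(t)\bigr)=0,\quad t\in\mathbb R,\qquad \varphi(-\infty)=0,\quad \varphi(+\infty)=1 .$$ Then $\varphi'(t)>0$ for all $t\in\mathbb R$, and $\chi_0$ has exactly two positive zeros $\lambda_2\le\lambda_1$, counted with multiplicity. Moreover, for some $\varepsilon>0$ and some $t_a,d\in\mathbb R$, $$\varphi(t+t_a)=e^{\lambda_2 t}\bigl((-t)^{j}+jd+o(e^{\varepsilon t})\bigr),\qquad t\to-\infty,$$ where $j=0$ if $\lambda_2<\lambda_1$ and $j=1$ if $\lambda_2=\lambda_1$. -/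

import Mathlib

open Filter Topology Asymptotics

noncomputable section

/-- The translation operator `(S g)(t) = g (t - c τ)`. -/
def shiftS (c τ : ℝ) (g : ℝ → ℝ) (t : ℝ) : ℝ :=
  g (t - c * τ)

/-- The operator `B = (I - b S)⁻¹ = ∑_{j ≥ 0} b ^ j S ^ j`, that is
`(B g)(t) = ∑_{j ≥ 0} b ^ j g (t - j c τ)`. It is used for bounded `g` and `0 ≤ b < 1` only, where
the series converges absolutely. -/
def neutralB (b c τ : ℝ) (g : ℝ → ℝ) (t : ℝ) : ℝ :=
  ∑' j : ℕ, b ^ j * g (t - j * (c * τ))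

/-- `w` is a `C²` solution of the boundary value problem
`w'' - c w' + (B w)(1 - (1 - b) S B w) = 0` on `ℝ`, `w(-∞) = 0`, `w(+∞) = 1`. -/
structure IsProfileSolution (b c τ : ℝ) (w : ℝ → ℝ) : Prop where
  contDiff : ContDiff ℝ 2 w
  equation : ∀ t : ℝ,
    deriv (deriv w) t - c * deriv w t
      + neutralB b c τ w t * (1 - (1 - b) * shiftS c τ (neutralB b c τ w) t) = 0
  tendsto_atBot : Tendsto w atBot (𝓝 0)
  tendsto_atTop : Tendsto w atTop (𝓝 1)

/-- The characteristic function `χ₀(z) = z² - c z + 1 / (1 - b e^{-z c τ})`. -/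
def chi0 (b c τ : ℝ) (z : ℂ) : ℂ :=
  z ^ 2 - c * z + 1 / (1 - b * Complex.exp (-z * c * τ))

end

/-! With `ψ = Bφ` and `h = cτ` the equation reads `φ'' - cφ' + ψ = N`, where `N = (1 - b) ψ (Sψ) >
0`. A zero of `φ'` is a minimum of `φ'`, so the reaction term vanishes there and `φ = 1` one delay
earlier. The value 1 then propagates to `-∞`, by steps of length `h` or, if `h = 0`, by uniqueness
for the ODE; this contradicts `φ(-∞) = 0`.

The two-sided Laplace transform turns the equation into `χ₀ φ̂ = N̂`. Since `N` is quadratic, an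
exponential rate for `φ` gives twice that rate for `N`, so `N̂` is analytic beyond the strip where
`φ̂` is known to converge. This bootstraps the decay of `φ` for as long as `χ₀ > 0` on the real axis
(`growth_improve`, `exp_bound_of_chiReal_pos`). The decay cannot exceed `e^{ct}`, because `φ' ≤ cφ`;
hence `χ₀` has a positive zero, and strict convexity allows at most two.

The least zero `l` is the only zero of `χ₀` on `Re z = l`, and zeros cannot accumulate at that line
(`exists_zero_free_strip`). If `l` has order `m`, applying `f ↦ f - l ∫_{-∞}^t f` to `φ` `m` times
multiplies `φ̂` by `((z - l)/z)^m` and cancels the pole. The contour then moves to the right of `l`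
(`exp_bound_iterate_reduceMode`). Undoing the reductions produces a polynomial of degree less than
`m` times `e^{lt}`, up to a smaller exponential. Its leading coefficient is nonzero because `N̂(l) >
0`, its sign follows from `φ ≥ 0`, and a translation normalises it. -/

open MeasureTheory

/-- The facts about a monotone front `φ` and `ψ = B φ` used in its asymptotic analysis; `h = c τ` is
the delay, and the series defining `ψ` enters only through `ψ t = φ t + b ψ (t - h)`. -/
structure IsMonotoneFront (b c h : ℝ) (φ ψ : ℝ → ℝ) : Prop where
  b_nonneg : 0 ≤ b
  b_lt_one : b < 1
  c_pos : 0 < c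
  h_nonneg : 0 ≤ h
  contDiff : ContDiff ℝ 2 φ
  mono : Monotone φ
  tendsto_atBot : Tendsto φ atBot (𝓝 0)
  tendsto_atTop : Tendsto φ atTop (𝓝 1)
  continuous_psi : Continuous ψ
  mono_psi : Monotone ψ
  psi_eq : ∀ t, ψ t = φ t + b * ψ (t - h)
  psi_nonneg : ∀ t, 0 ≤ ψ t
  psi_le : ∀ t, (1 - b) * ψ t ≤ 1
  equation : ∀ t, deriv (deriv φ) t - c * deriv φ t + ψ t * (1 - (1 - b) * ψ (t - h)) = 0

theorem IsProfileSolution.isMonotoneFront {b c τ : ℝ} {φ : ℝ → ℝ} (hb0 : 0 ≤ b) (hb1 : b < 1)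
    (hc : 0 < c) (hτ : 0 ≤ τ) (hφ : IsProfileSolution b c τ φ) (hmono : Monotone φ) :
    IsMonotoneFront b c (c * τ) φ (neutralB b c τ φ) := by
  have h0 : ∀ t, 0 ≤ φ t := fun t => hmono.le_of_tendsto hφ.tendsto_atBot t
  have h1 : ∀ t, φ t ≤ 1 := fun t => hmono.ge_of_tendsto hφ.tendsto_atTop t
  have hg := summable_geometric_of_lt_one hb0 hb1
  have hs : ∀ t, Summable fun j : ℕ => b ^ j * φ (t - j * (c * τ)) := fun t =>
    Summable.of_nonneg_of_le (fun j => mul_nonneg (pow_nonneg hb0 j) (h0 _))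
      (fun j => mul_le_of_le_one_right (pow_nonneg hb0 j) (h1 _)) hg
  have hcont := hφ.contDiff.continuous
  refine ⟨hb0, hb1, hc, mul_nonneg hc.le hτ, hφ.contDiff, hmono, hφ.tendsto_atBot,
    hφ.tendsto_atTop, ?_, ?_, ?_, ?_, ?_, hφ.equation⟩
  · refine continuous_tsum (u := fun j : ℕ => b ^ j) (fun j => by fun_prop) hg fun j t => ?_
    rw [Real.norm_of_nonneg (mul_nonneg (pow_nonneg hb0 j) (h0 _))]
    exact mul_le_of_le_one_right (pow_nonneg hb0 j) (h1 _)
  · intro s t hst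
    exact (hs s).tsum_le_tsum (fun j => mul_le_mul_of_nonneg_left (hmono (by linarith))
      (pow_nonneg hb0 j)) (hs t)
  · intro t
    unfold neutralB
    rw [(hs t).tsum_eq_zero_add, ← tsum_mul_left]
    simp only [pow_zero, Nat.cast_zero, zero_mul, sub_zero, one_mul]
    congr 1
    refine tsum_congr fun j => ?_
    rw [pow_succ']
    push_cast
    rw [mul_assoc]
    congr 3
    ring
  · exact fun t => tsum_nonneg fun j => mul_nonneg (pow_nonneg hb0 j) (h0 _)
  · intro t
    have := (hs t).tsum_le_tsum (fun j => mul_le_of_le_one_right (pow_nonneg hb0 j) (h1 _)) hg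
    rw [tsum_geometric_of_lt_one hb0 hb1] at this
    have hb : 0 < 1 - b := by linarith
    calc (1 - b) * neutralB b c τ φ t ≤ (1 - b) * (1 - b)⁻¹ :=
          mul_le_mul_of_nonneg_left this hb.le
      _ = 1 := mul_inv_cancel₀ hb.ne'

/-! ### Flux inequality and strict monotonicity of the front. -/

namespace IsMonotoneFront

variable {b c h : ℝ} {φ ψ : ℝ → ℝ}

theorem nonneg (H : IsMonotoneFront b c h φ ψ) (t : ℝ) : 0 ≤ φ t :=
  H.mono.le_of_tendsto H.tendsto_atBot t

theorem le_one (H : IsMonotoneFront b c h φ ψ) (t : ℝ) : φ t ≤ 1 :=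
  H.mono.ge_of_tendsto H.tendsto_atTop t

theorem one_sub_b_pos (H : IsMonotoneFront b c h φ ψ) : 0 < 1 - b := by
  linarith [H.b_lt_one]

theorem le_psi (H : IsMonotoneFront b c h φ ψ) (t : ℝ) : φ t ≤ ψ t := by
  rw [H.psi_eq t]
  linarith [mul_nonneg H.b_nonneg (H.psi_nonneg (t - h))]

theorem hasDerivAt (H : IsMonotoneFront b c h φ ψ) (t : ℝ) : HasDerivAt φ (deriv φ t) t :=
  (H.contDiff.differentiable (by norm_num) t).hasDerivAt

theorem contDiff_deriv (H : IsMonotoneFront b c h φ ψ) : ContDiff ℝ 1 (deriv φ) :=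
  ((contDiff_succ_iff_deriv (n := 1)).1 H.contDiff).2.2

theorem hasDerivAt_deriv (H : IsMonotoneFront b c h φ ψ) (t : ℝ) :
    HasDerivAt (deriv φ) (deriv (deriv φ) t) t :=
  (H.contDiff_deriv.differentiable (by norm_num) t).hasDerivAt

theorem deriv_nonneg (H : IsMonotoneFront b c h φ ψ) (t : ℝ) : 0 ≤ deriv φ t :=
  H.mono.deriv_nonneg

theorem reaction_nonneg (H : IsMonotoneFront b c h φ ψ) (t : ℝ) :
    0 ≤ ψ t * (1 - (1 - b) * ψ (t - h)) :=
  mul_nonneg (H.psi_nonneg t) (by linarith [H.psi_le (t - h)])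

theorem tendsto_psi_atBot (H : IsMonotoneFront b c h φ ψ) : Tendsto ψ atBot (𝓝 0) := by
  have hbd : BddBelow (Set.range ψ) := ⟨0, by rintro _ ⟨t, rfl⟩; exact H.psi_nonneg t⟩
  have hl := tendsto_atBot_ciInf H.mono_psi hbd
  set l := ⨅ t, ψ t
  have hsh : Tendsto (fun t : ℝ => t - h) atBot atBot := tendsto_atBot_add_const_right _ _ tendsto_id
  have h2 : Tendsto ψ atBot (𝓝 (0 + b * l)) := by
    refine (H.tendsto_atBot.add ((hl.comp hsh).const_mul b)).congr fun t => ?_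
    exact (H.psi_eq t).symm
  have h3 := tendsto_nhds_unique hl h2
  have : l = 0 := by
    have : (1 - b) * l = 0 := by linarith
    exact (mul_eq_zero.1 this).resolve_left H.one_sub_b_pos.ne'
  rwa [this] at hl

/-- The flux `φ' - c φ` is antitone, since the reaction term is nonnegative. -/
theorem antitone_flux (H : IsMonotoneFront b c h φ ψ) :
    Antitone fun t => deriv φ t - c * φ t := by
  refine antitone_of_hasDerivAt_nonpos
    (fun t => (H.hasDerivAt_deriv t).sub ((H.hasDerivAt t).const_mul c)) fun t => ?_
  have := H.equation t
  have := H.reaction_nonneg t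
  simp only [Pi.zero_apply]
  linarith

/-- A positive flux `δ` at `t` persists to the left, so `φ' ≥ δ` there and `φ` drops by at least 2
over a length `2 / δ`, impossible for values in `[0, 1]`. -/
theorem deriv_le (H : IsMonotoneFront b c h φ ψ) (t : ℝ) : deriv φ t ≤ c * φ t := by
  by_contra! hlt
  set δ := deriv φ t - c * φ t with hδ
  have hδ0 : 0 < δ := by linarith
  have hmono : MonotoneOn (fun s => φ s - δ * s) (Set.Iic t) := by
    refine monotoneOn_of_deriv_nonneg (convex_Iic t) ?_ ?_ ?_
    · exact (H.contDiff.continuous.sub (by fun_prop)).continuousOn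
    · intro s _
      exact ((H.hasDerivAt s).sub ((hasDerivAt_id s).const_mul δ)).differentiableAt.differentiableWithinAt
    · intro s hs
      rw [interior_Iic] at hs
      have hd : deriv (fun s => φ s - δ * s) s = deriv φ s - δ * 1 :=
        ((H.hasDerivAt s).sub ((hasDerivAt_id s).const_mul δ)).deriv
      rw [hd]
      have h1 := H.antitone_flux (Set.mem_Iio.1 hs).le
      have h2 := mul_nonneg H.c_pos.le (H.nonneg s)
      simp only at h1
      linarith
  have h1 := hmono (show t - 2 / δ ∈ Set.Iic t by
    simp only [Set.mem_Iic]; linarith [div_pos two_pos hδ0]) (Set.mem_Iic.2 le_rfl)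
    (by linarith [div_pos two_pos hδ0])
  simp only at h1
  have h2 : δ * (t - 2 / δ) = δ * t - 2 := by field_simp
  rw [h2] at h1
  linarith [H.nonneg (t - 2 / δ), H.le_one t]

end IsMonotoneFront

namespace IsMonotoneFront

variable {b c h : ℝ} {φ ψ : ℝ → ℝ}

theorem antitone_exp_mul (H : IsMonotoneFront b c h φ ψ) :
    Antitone fun t => Real.exp (-c * t) * φ t := by
  refine antitone_of_hasDerivAt_nonpos (fun t =>
    (((hasDerivAt_id t).const_mul (-c)).exp).mul (H.hasDerivAt t)) fun t => ?_
  have h1 := H.deriv_le t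
  have h2 := Real.exp_pos (-c * t)
  simp only [id, Pi.zero_apply]
  nlinarith

theorem pos (H : IsMonotoneFront b c h φ ψ) (t : ℝ) : 0 < φ t := by
  refine (H.nonneg t).lt_of_ne' fun h0 => ?_
  have h1 : ∀ s, t ≤ s → φ s ≤ 0 := by
    intro s hs
    have := H.antitone_exp_mul hs
    simp only [h0, mul_zero] at this
    exact nonpos_of_mul_nonpos_right this (Real.exp_pos _)
  have := le_of_tendsto H.tendsto_atTop (eventually_atTop.2 ⟨t, h1⟩)
  linarith

theorem psi_pos (H : IsMonotoneFront b c h φ ψ) (t : ℝ) : 0 < ψ t :=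
  (H.pos t).trans_le (H.le_psi t)

theorem eq_one_of_psi (H : IsMonotoneFront b c h φ ψ) {s : ℝ} (hs : (1 - b) * ψ s = 1) :
    φ s = 1 := by
  have h1 := H.psi_eq s
  have h2 := mul_le_mul_of_nonneg_left (H.psi_le (s - h)) H.b_nonneg
  have h3 : (1 - b) * 1 ≤ (1 - b) * φ s := by
    rw [h1] at hs
    linarith
  exact le_antisymm (H.le_one s) (le_of_mul_le_mul_left h3 H.one_sub_b_pos)

/-- Since `φ' ≥ 0`, a zero of `φ'` is a minimum of `φ'`; there `φ'' = 0` too, so the reaction term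
vanishes, and its factor `ψ` is positive. -/
theorem psi_eq_of_deriv_eq_zero (H : IsMonotoneFront b c h φ ψ) {t : ℝ} (ht : deriv φ t = 0) :
    (1 - b) * ψ (t - h) = 1 := by
  have hmin : IsLocalMin (deriv φ) t := Eventually.of_forall fun s => by
    rw [ht]; exact H.deriv_nonneg s
  have h1 := H.equation t
  rw [hmin.deriv_eq_zero, ht, mul_zero, sub_zero, zero_add] at h1
  linarith [(mul_eq_zero.1 h1).resolve_left (H.psi_pos t).ne']

theorem deriv_eq_zero_of_eq_one (H : IsMonotoneFront b c h φ ψ) {t : ℝ} (ht : φ t = 1) :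
    deriv φ t = 0 := by
  have hmax : IsLocalMax φ t := Eventually.of_forall fun s => by
    rw [ht]; exact H.le_one s
  exact hmax.deriv_eq_zero

theorem not_forall_eq_one (H : IsMonotoneFront b c h φ ψ) {u : ℕ → ℝ}
    (hu : Tendsto u atTop atBot) : ¬ ∀ n, φ (u n) = 1 := by
  intro h1
  have h2 := H.tendsto_atBot.comp hu
  have h3 : (φ ∘ u) = fun _ => (1 : ℝ) := funext h1
  rw [h3] at h2
  exact one_ne_zero (tendsto_nhds_unique tendsto_const_nhds h2)

/-- The value 1 at `t` is a maximum, so `φ' = 0` and the value 1 recurs at `t - h`; iteration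
contradicts the limit 0. -/
theorem ne_one_of_delay_pos (H : IsMonotoneFront b c h φ ψ) (hh : 0 < h) (t : ℝ) : φ t ≠ 1 := by
  intro ht
  refine H.not_forall_eq_one (u := fun n : ℕ => t - n * h) ?_ fun n => ?_
  · exact tendsto_atBot_add_const_left _ t
      (tendsto_neg_atTop_atBot.comp (tendsto_natCast_atTop_atTop.atTop_mul_const hh))
  · induction n with
    | zero => simpa using ht
    | succ n ih =>
      have h2 := H.eq_one_of_psi (H.psi_eq_of_deriv_eq_zero (H.deriv_eq_zero_of_eq_one ih))
      rw [← h2]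
      congr 1
      push_cast
      ring

/-- Without delay this is backward uniqueness for a second-order ODE at the equilibrium `(1, 0)`, by
a Gronwall argument. -/
theorem ne_one_of_delay_zero (H : IsMonotoneFront b c 0 φ ψ) (t : ℝ) : φ t ≠ 1 := by
  intro ht
  have hψ : ∀ s, ψ s = (1 - b)⁻¹ * φ s := fun s => by
    have h1 := H.psi_eq s
    rw [sub_zero] at h1
    rw [eq_inv_mul_iff_mul_eq₀ H.one_sub_b_pos.ne']
    linarith
  have hk : 0 < (1 - b)⁻¹ := inv_pos.2 H.one_sub_b_pos
  set k := (1 - b)⁻¹ with hkdef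
  have hbk : (1 - b) * k = 1 := mul_inv_cancel₀ H.one_sub_b_pos.ne'
  have heq : ∀ s, deriv (deriv φ) s = c * deriv φ s - k * φ s * (1 - φ s) := fun s => by
    have h1 := H.equation s
    rw [sub_zero, hψ, ← mul_assoc, hbk, one_mul] at h1
    linarith
  -- The rate `1 + k` absorbs the cross terms `2(1 - φ)φ'` and `2kφ(1 - φ)φ'`; the damping term
  -- `2cφ'²` has the favourable sign.
  have hmono : Monotone fun s => Real.exp ((1 + k) * s) * ((1 - φ s) ^ 2 + deriv φ s ^ 2) := by
    refine monotone_of_hasDerivAt_nonneg (fun s => (((hasDerivAt_id s).const_mul (1 + k)).exp).mul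
      ((((H.hasDerivAt s).const_sub 1).pow 2).add ((H.hasDerivAt_deriv s).pow 2))) fun s => ?_
    have he := Real.exp_pos ((1 + k) * s)
    simp only [id, Pi.zero_apply, heq s]
    set p := φ s
    set q := deriv φ s
    have hp0 : 0 ≤ p := H.nonneg s
    have hp1 : p ≤ 1 := H.le_one s
    have key : 0 ≤ (1 + k) * ((1 - p) ^ 2 + q ^ 2) +
        (2 * (1 - p) * -q + 2 * q * (c * q - k * p * (1 - p))) := by
      have h1 : 0 ≤ ((1 - p) - q) ^ 2 := sq_nonneg _
      have h2 : 0 ≤ 2 * (c * q ^ 2) := by have := H.c_pos; positivity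
      have h3 : 0 ≤ k * (p * ((1 - p) - q) ^ 2 + (1 - p) * ((1 - p) ^ 2 + q ^ 2)) := by
        have : 0 ≤ 1 - p := by linarith
        positivity
      nlinarith
    have := mul_nonneg he.le key
    norm_num
    nlinarith
  have h0 : ∀ s ≤ t, φ s = 1 := fun s hs => by
    have h1 := hmono hs
    simp only [ht, H.deriv_eq_zero_of_eq_one ht] at h1
    norm_num at h1
    have h2 := nonpos_of_mul_nonpos_right h1 (Real.exp_pos _)
    nlinarith [sq_nonneg (1 - φ s), sq_nonneg (deriv φ s)]
  refine H.not_forall_eq_one (u := fun n : ℕ => t - n) ?_ fun n => h0 _ (by simp)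
  exact tendsto_atBot_add_const_left _ t
    (tendsto_neg_atTop_atBot.comp tendsto_natCast_atTop_atTop)

theorem ne_one (H : IsMonotoneFront b c h φ ψ) (t : ℝ) : φ t ≠ 1 := by
  rcases H.h_nonneg.eq_or_lt with rfl | hh
  · exact H.ne_one_of_delay_zero t
  · exact H.ne_one_of_delay_pos hh t

theorem deriv_pos (H : IsMonotoneFront b c h φ ψ) (t : ℝ) : 0 < deriv φ t :=
  (H.deriv_nonneg t).lt_of_ne' fun h0 =>
    H.ne_one _ (H.eq_one_of_psi (H.psi_eq_of_deriv_eq_zero h0))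

/-- The quadratic part `(1 - b) ψ (S ψ)` of the reaction term is positive. -/
theorem quadratic_pos (H : IsMonotoneFront b c h φ ψ) (t : ℝ) :
    0 < (1 - b) * ψ t * ψ (t - h) :=
  mul_pos (mul_pos H.one_sub_b_pos (H.psi_pos t)) (H.psi_pos _)

end IsMonotoneFront

/-! ### Half-line integrals with exponential weights, and bounds inherited by `ψ` and `N`. -/

theorem hasDerivAt_integral_Iic {f : ℝ → ℝ} (hf : Continuous f)
    (hi : ∀ t, IntegrableOn f (Set.Iic t)) (t : ℝ) :
    HasDerivAt (fun t => ∫ s in Set.Iic t, f s) (f t) t := by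
  have h1 : (fun t => ∫ s in Set.Iic t, f s)
      = fun t => (∫ s in Set.Iic 0, f s) + ∫ s in (0 : ℝ)..t, f s := by
    funext u
    rw [← intervalIntegral.integral_Iic_sub_Iic (hi 0) (hi u)]
    ring
  rw [h1]
  exact (intervalIntegral.integral_hasDerivAt_right (hf.intervalIntegrable _ _)
    hf.aestronglyMeasurable.stronglyMeasurableAtFilter hf.continuousAt).const_add _

theorem hasDerivAt_integral_Ioi {f : ℝ → ℝ} (hf : Continuous f)
    (hi : ∀ t, IntegrableOn f (Set.Ioi t)) (t : ℝ) :
    HasDerivAt (fun t => ∫ s in Set.Ioi t, f s) (-f t) t := by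
  have h1 : (fun t => ∫ s in Set.Ioi t, f s)
      = fun t => (∫ s in Set.Ioi 0, f s) - ∫ s in (0 : ℝ)..t, f s := by
    funext u
    rw [← intervalIntegral.integral_interval_add_Ioi (hi 0) (hi u)]
    ring
  rw [h1]
  exact (intervalIntegral.integral_hasDerivAt_right (hf.intervalIntegrable _ _)
    hf.aestronglyMeasurable.stronglyMeasurableAtFilter hf.continuousAt).const_sub _

theorem integrableOn_Ioi_exp_mul_of_le {f : ℝ → ℝ} (hf : Continuous f) {C μ x : ℝ}
    (hC : ∀ t, |f t| ≤ C * Real.exp (μ * t)) (hx : μ < x) (t : ℝ) :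
    IntegrableOn (fun s => Real.exp (-x * s) * f s) (Set.Ioi t) := by
  refine ((integrableOn_exp_mul_Ioi (a := μ - x) (by linarith) t).const_mul C).mono'
    (by fun_prop) (Eventually.of_forall fun s => ?_)
  rw [norm_mul, Real.norm_eq_abs, Real.norm_eq_abs, Real.abs_exp,
    show (μ - x) * s = μ * s + -x * s by ring, Real.exp_add]
  nlinarith [hC s, Real.exp_pos (-x * s)]

theorem integrableOn_Iic_exp_mul_of_le {f : ℝ → ℝ} (hf : Continuous f) {C μ x : ℝ}
    (hC : ∀ t, |f t| ≤ C * Real.exp (μ * t)) (hx : x < μ) (t : ℝ) :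
    IntegrableOn (fun s => Real.exp (-x * s) * f s) (Set.Iic t) := by
  refine ((integrableOn_exp_mul_Iic (a := μ - x) (by linarith) t).const_mul C).mono'
    (by fun_prop) (Eventually.of_forall fun s => ?_)
  rw [norm_mul, Real.norm_eq_abs, Real.norm_eq_abs, Real.abs_exp,
    show (μ - x) * s = μ * s + -x * s by ring, Real.exp_add]
  nlinarith [hC s, Real.exp_pos (-x * s)]

theorem integrable_exp_mul_of_le {f : ℝ → ℝ} (hf : Continuous f) {C₁ C₂ μ₁ μ₂ x : ℝ}
    (h₁ : ∀ t, |f t| ≤ C₁ * Real.exp (μ₁ * t)) (h₂ : ∀ t, |f t| ≤ C₂ * Real.exp (μ₂ * t))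
    (hx₁ : μ₁ < x) (hx₂ : x < μ₂) :
    Integrable (fun s => Real.exp (-x * s) * f s) := by
  rw [← integrableOn_univ, ← Set.Iic_union_Ioi (a := (0 : ℝ))]
  exact (integrableOn_Iic_exp_mul_of_le hf h₂ hx₂ 0).union
    (integrableOn_Ioi_exp_mul_of_le hf h₁ hx₁ 0)

theorem setIntegral_Ioi_comp_sub (f : ℝ → ℝ) (t a : ℝ) :
    ∫ s in Set.Ioi t, f (s - a) = ∫ s in Set.Ioi (t - a), f s := by
  rw [← integral_indicator measurableSet_Ioi, ← integral_indicator measurableSet_Ioi,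
    ← integral_sub_right_eq_self ((Set.Ioi (t - a)).indicator f) a]
  congr 1
  funext s
  simp [Set.indicator_apply]

/-- The restriction of the characteristic function to the real line. -/
noncomputable def chiReal (b c h x : ℝ) : ℝ :=
  x ^ 2 - c * x + 1 / (1 - b * Real.exp (-x * h))

namespace IsMonotoneFront

variable {b c h : ℝ} {φ ψ : ℝ → ℝ}

theorem one_sub_pos (H : IsMonotoneFront b c h φ ψ) {x : ℝ} (hx : 0 ≤ x) :
    0 < 1 - b * Real.exp (-x * h) := by
  have h1 : Real.exp (-x * h) ≤ 1 := Real.exp_le_one_iff.2 (by nlinarith [H.h_nonneg])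
  nlinarith [H.b_lt_one, H.b_nonneg, Real.exp_pos (-x * h)]

theorem abs_le (H : IsMonotoneFront b c h φ ψ) (t : ℝ) : |φ t| ≤ 1 * Real.exp (0 * t) := by
  simp [abs_of_nonneg (H.nonneg t), H.le_one t]

theorem psi_le' (H : IsMonotoneFront b c h φ ψ) (t : ℝ) : ψ t ≤ (1 - b)⁻¹ := by
  rw [← one_div, le_div_iff₀' H.one_sub_b_pos]
  exact H.psi_le t

theorem abs_psi_le (H : IsMonotoneFront b c h φ ψ) (t : ℝ) :
    |ψ t| ≤ (1 - b)⁻¹ * Real.exp (0 * t) := by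
  simp [abs_of_nonneg (H.psi_nonneg t), H.psi_le' t]

theorem continuous_quadratic (H : IsMonotoneFront b c h φ ψ) :
    Continuous fun t => (1 - b) * ψ t * ψ (t - h) := by
  have := H.continuous_psi
  fun_prop

theorem quadratic_le_psi (H : IsMonotoneFront b c h φ ψ) (t : ℝ) :
    (1 - b) * ψ t * ψ (t - h) ≤ ψ t := by
  have := H.reaction_nonneg t
  linarith

theorem abs_quadratic_le (H : IsMonotoneFront b c h φ ψ) (t : ℝ) :
    |(1 - b) * ψ t * ψ (t - h)| ≤ (1 - b)⁻¹ * Real.exp (0 * t) := by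
  rw [abs_of_pos (H.quadratic_pos t), zero_mul, Real.exp_zero, mul_one]
  exact (H.quadratic_le_psi t).trans (H.psi_le' t)

theorem psi_le_exp (H : IsMonotoneFront b c h φ ψ) {y C : ℝ} (hy : 0 ≤ y)
    (hC : ∀ t, φ t ≤ C * Real.exp (y * t)) (t : ℝ) :
    ψ t ≤ C * (1 - b)⁻¹ * Real.exp (y * t) := by
  have hk : 0 < (1 - b)⁻¹ := inv_pos.2 H.one_sub_b_pos
  have hbk : (1 - b) * (1 - b)⁻¹ = 1 := mul_inv_cancel₀ H.one_sub_b_pos.ne'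
  set k := (1 - b)⁻¹
  have hC0 : 0 ≤ C := by
    have := (H.nonneg 0).trans (hC 0)
    simpa using this
  -- The constant `C k` is fixed by `M ↦ C + b M`, while the crude bound `k` on `ψ` shrinks by a
  -- factor `b` at each use of `psi_eq`.
  have key : ∀ n : ℕ, ∀ t, ψ t ≤ C * k * Real.exp (y * t) + b ^ n * k := by
    intro n
    induction n with
    | zero =>
      intro t
      have := H.psi_le' t
      have : 0 ≤ C * k * Real.exp (y * t) := by positivity
      simp only [pow_zero, one_mul]
      linarith
    | succ n ih =>
      intro t
      rw [H.psi_eq t]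
      have h1 : Real.exp (y * (t - h)) ≤ Real.exp (y * t) :=
        Real.exp_le_exp.2 (by nlinarith [H.h_nonneg])
      have h2 : ψ (t - h) ≤ C * k * Real.exp (y * t) + b ^ n * k :=
        (ih _).trans (by gcongr)
      have h3 := mul_le_mul_of_nonneg_left h2 H.b_nonneg
      have h4 : C * k * Real.exp (y * t) = C * Real.exp (y * t) + b * (C * k * Real.exp (y * t)) := by
        linear_combination C * Real.exp (y * t) * hbk
      rw [pow_succ']
      linarith [hC t]
  have hlim : Tendsto (fun n : ℕ => C * k * Real.exp (y * t) + b ^ n * k) atTop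
      (𝓝 (C * k * Real.exp (y * t) + 0 * k)) :=
    ((tendsto_pow_atTop_nhds_zero_of_lt_one H.b_nonneg H.b_lt_one).mul_const k).const_add _
  rw [zero_mul, add_zero] at hlim
  exact ge_of_tendsto' hlim fun n => key n t

/-- Each factor `ψ` contributes the rate `y`. The doubled rate is what places the transform of the
nonlinearity beyond that of `φ`. -/
theorem quadratic_le_exp (H : IsMonotoneFront b c h φ ψ) {y C : ℝ} (hy : 0 ≤ y)
    (hC : ∀ t, φ t ≤ C * Real.exp (y * t)) :
    ∃ C', ∀ t, |(1 - b) * ψ t * ψ (t - h)| ≤ C' * Real.exp (2 * y * t) := by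
  refine ⟨(1 - b) * (C * (1 - b)⁻¹) ^ 2, fun t => ?_⟩
  rw [abs_of_pos (H.quadratic_pos t), show 2 * y * t = y * t + y * t by ring, Real.exp_add]
  have h1 := H.psi_le_exp hy hC t
  have h2 : ψ (t - h) ≤ C * (1 - b)⁻¹ * Real.exp (y * t) :=
    (H.mono_psi (by linarith [H.h_nonneg])).trans h1
  have h3 := mul_le_mul h1 h2 (H.psi_nonneg _) ((H.psi_nonneg t).trans h1)
  have := mul_le_mul_of_nonneg_left h3 H.one_sub_b_pos.le
  linarith

theorem le_exp_of_le (H : IsMonotoneFront b c h φ ψ) {x y C : ℝ} (hy : 0 ≤ y) (hyx : y ≤ x)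
    (hC : ∀ t, φ t ≤ C * Real.exp (x * t)) : ∃ C', ∀ t, φ t ≤ C' * Real.exp (y * t) := by
  refine ⟨max C 1, fun t => ?_⟩
  rcases le_total t 0 with ht | ht
  · refine (hC t).trans (mul_le_mul (le_max_left _ _) (Real.exp_le_exp.2 (by nlinarith))
      (Real.exp_pos _).le (by positivity))
  · exact (H.le_one t).trans
      (one_le_mul_of_one_le_of_one_le (le_max_right _ _) (Real.one_le_exp (by positivity)))

end IsMonotoneFront

/-! ### Bootstrapping the exponential rate, and existence of a real zero of `χ₀`. -/

namespace IsMonotoneFront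

variable {b c h : ℝ} {φ ψ : ℝ → ℝ}

/-- The equation times `e^{-xs}`, integrated over `(t, ∞)`. One-sided integrals converge for bounded
`φ`, whereas no decay at `-∞` is known yet. -/
theorem tail_identity (H : IsMonotoneFront b c h φ ψ) {x : ℝ} (hx : 0 < x) (t : ℝ) :
    (∫ s in Set.Ioi t, Real.exp (-x * s) * ψ s)
      - x * (c - x) * ∫ s in Set.Ioi t, Real.exp (-x * s) * φ s
    = (∫ s in Set.Ioi t, Real.exp (-x * s) * ((1 - b) * ψ s * ψ (s - h)))
      + Real.exp (-x * t) * (deriv φ t + (x - c) * φ t) := by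
  have iφ := integrableOn_Ioi_exp_mul_of_le H.contDiff.continuous H.abs_le hx t
  have iψ := integrableOn_Ioi_exp_mul_of_le H.continuous_psi H.abs_psi_le hx t
  have iN := integrableOn_Ioi_exp_mul_of_le H.continuous_quadratic H.abs_quadratic_le hx t
  have hd : ∀ s, HasDerivAt (fun s => Real.exp (-x * s) * (deriv φ s + (x - c) * φ s))
      (Real.exp (-x * s) * ((1 - b) * ψ s * ψ (s - h)) - Real.exp (-x * s) * ψ s
        + x * (c - x) * (Real.exp (-x * s) * φ s)) s := by
    intro s
    have h1 := (((hasDerivAt_id s).const_mul (-x)).exp).mul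
      ((H.hasDerivAt_deriv s).add ((H.hasDerivAt s).const_mul (x - c)))
    refine h1.congr_deriv ?_
    have h2 : deriv (deriv φ) s
      = c * deriv φ s - ψ s * (1 - (1 - b) * ψ (s - h)) := by linarith [H.equation s]
    simp only [id, h2, Pi.add_apply]
    ring
  have hlim : Tendsto (fun s => Real.exp (-x * s) * (deriv φ s + (x - c) * φ s)) atTop (𝓝 0) := by
    have h1 : Tendsto (fun s => (c + |x - c|) * Real.exp (-x * s)) atTop (𝓝 ((c + |x - c|) * 0)) := by
      refine (Real.tendsto_exp_atBot.comp ?_).const_mul _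
      exact tendsto_id.const_mul_atTop_of_neg (by linarith)
    rw [mul_zero] at h1
    refine squeeze_zero_norm (fun s => ?_) h1
    rw [norm_mul, Real.norm_eq_abs, Real.norm_eq_abs, Real.abs_exp, mul_comm]
    refine mul_le_mul_of_nonneg_right ((abs_add_le _ _).trans (add_le_add ?_ ?_)) (Real.exp_pos _).le
    · rw [abs_of_nonneg (H.deriv_nonneg s)]
      have := H.deriv_le s
      nlinarith [H.le_one s, H.c_pos]
    · rw [abs_mul, abs_of_nonneg (H.nonneg s)]
      exact mul_le_of_le_one_right (abs_nonneg _) (H.le_one s)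
  have iNψ : IntegrableOn (fun s => Real.exp (-x * s) * ((1 - b) * ψ s * ψ (s - h))
      - Real.exp (-x * s) * ψ s) (Set.Ioi t) := iN.sub iψ
  have h1 := integral_Ioi_of_hasDerivAt_of_tendsto (hd t).continuousAt.continuousWithinAt
    (fun s _ => hd s) (iNψ.add (iφ.const_mul _)) hlim
  rw [integral_add iNψ (iφ.const_mul _), integral_sub iN iψ, integral_const_mul] at h1
  linarith

/-- Shifting by the delay enlarges the half-line to `(t - h, ∞)`, and `ψ ≥ 0`; so the transform
relation `ψ̂ = φ̂ / (1 - b e^{-xh})` survives as an inequality for tails. -/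
theorem tail_psi_ge (H : IsMonotoneFront b c h φ ψ) {x : ℝ} (hx : 0 < x) (t : ℝ) :
    1 / (1 - b * Real.exp (-x * h)) * (∫ s in Set.Ioi t, Real.exp (-x * s) * φ s)
      ≤ ∫ s in Set.Ioi t, Real.exp (-x * s) * ψ s := by
  have iφ := integrableOn_Ioi_exp_mul_of_le H.contDiff.continuous H.abs_le hx t
  have iψ := fun t => integrableOn_Ioi_exp_mul_of_le H.continuous_psi H.abs_psi_le hx t
  have ish : IntegrableOn (fun s => Real.exp (-x * s) * ψ (s - h)) (Set.Ioi t) := by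
    refine integrableOn_Ioi_exp_mul_of_le (f := fun s => ψ (s - h))
      (by have := H.continuous_psi; fun_prop) (C := (1 - b)⁻¹) (μ := 0) (fun s => ?_) hx t
    simpa using H.abs_psi_le (s - h)
  have h1 : (∫ s in Set.Ioi t, Real.exp (-x * s) * ψ s)
      = (∫ s in Set.Ioi t, Real.exp (-x * s) * φ s)
        + b * ∫ s in Set.Ioi t, Real.exp (-x * s) * ψ (s - h) := by
    rw [← integral_const_mul, ← integral_add iφ (ish.const_mul b)]
    refine integral_congr_ae (Eventually.of_forall fun s => ?_)
    simp only
    rw [H.psi_eq s]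
    ring
  have h2 : (∫ s in Set.Ioi t, Real.exp (-x * s) * ψ (s - h))
      = Real.exp (-x * h) * ∫ s in Set.Ioi (t - h), Real.exp (-x * s) * ψ s := by
    rw [← setIntegral_Ioi_comp_sub, ← integral_const_mul]
    refine integral_congr_ae (Eventually.of_forall fun s => ?_)
    simp only
    rw [← mul_assoc, ← Real.exp_add]
    ring_nf
  have h3 : (∫ s in Set.Ioi t, Real.exp (-x * s) * ψ s)
      ≤ ∫ s in Set.Ioi (t - h), Real.exp (-x * s) * ψ s :=
    setIntegral_mono_set (iψ _) (Eventually.of_forall fun s =>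
      mul_nonneg (Real.exp_pos _).le (H.psi_nonneg s))
      (Set.Ioi_subset_Ioi (by linarith [H.h_nonneg])).eventuallyLE
  rw [one_div, inv_mul_le_iff₀ (H.one_sub_pos hx.le)]
  have h4 := mul_le_mul_of_nonneg_left h3
    (mul_nonneg H.b_nonneg (Real.exp_pos (-x * h)).le)
  rw [h2] at h1
  linarith

/-- A self-improving exponential bound: an exponential rate `y` can be increased to `x` as long as
the linearised characteristic function dominates `x (x - y)`. -/
theorem growth_improve (H : IsMonotoneFront b c h φ ψ) {x y C θ : ℝ} {G : ℝ → ℝ} (hx : 0 < x)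
    (hyx : y < x) (hφ : ∀ t, φ t ≤ C * Real.exp (y * t)) (hθ : θ ≤ 1) (hG : Integrable G)
    (hG0 : ∀ s, 0 ≤ G s)
    (hN : ∀ s, Real.exp (-x * s) * ((1 - b) * ψ s * ψ (s - h))
      ≤ θ * (Real.exp (-x * s) * ψ s) + G s)
    (hκ : x * (x - y) < x ^ 2 - c * x + (1 - θ) * (1 / (1 - b * Real.exp (-x * h)))) :
    ∃ C', ∀ t, φ t ≤ C' * Real.exp (x * t) := by
  have iφ := fun t => integrableOn_Ioi_exp_mul_of_le H.contDiff.continuous H.abs_le hx t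
  set E : ℝ → ℝ := fun t => ∫ s in Set.Ioi t, Real.exp (-x * s) * φ s with hE
  set K : ℝ := ∫ s, G s with hK
  have hK0 : 0 ≤ K := integral_nonneg hG0
  set m := x ^ 2 - c * x + (1 - θ) * (1 / (1 - b * Real.exp (-x * h))) with hm
  have hxy : 0 < x - y := by linarith
  have hm0 : 0 < m := (mul_pos hx hxy).trans hκ
  have hineq : ∀ t, m * E t ≤ K + x * (Real.exp (-x * t) * φ t) := by
    intro t
    have iψ := integrableOn_Ioi_exp_mul_of_le H.continuous_psi H.abs_psi_le hx t
    have iN := integrableOn_Ioi_exp_mul_of_le H.continuous_quadratic H.abs_quadratic_le hx t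
    have h1 := H.tail_identity hx t
    have h2 := mul_le_mul_of_nonneg_left (H.tail_psi_ge hx t) (sub_nonneg.2 hθ)
    have h3 : (∫ s in Set.Ioi t, Real.exp (-x * s) * ((1 - b) * ψ s * ψ (s - h)))
        ≤ θ * (∫ s in Set.Ioi t, Real.exp (-x * s) * ψ s) + K := by
      calc _ ≤ ∫ s in Set.Ioi t, (θ * (Real.exp (-x * s) * ψ s) + G s) :=
            integral_mono iN ((iψ.const_mul θ).add hG.integrableOn) hN
        _ = θ * (∫ s in Set.Ioi t, Real.exp (-x * s) * ψ s) + ∫ s in Set.Ioi t, G s := by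
            rw [integral_add (iψ.const_mul θ) hG.integrableOn, integral_const_mul]
        _ ≤ _ := by
            gcongr
            exact setIntegral_le_integral hG (Eventually.of_forall hG0)
    have h4 : Real.exp (-x * t) * (deriv φ t + (x - c) * φ t) ≤ x * (Real.exp (-x * t) * φ t) := by
      have := mul_le_mul_of_nonneg_left (H.deriv_le t) (Real.exp_pos (-x * t)).le
      linarith
    have h5 : m * E t = (1 - θ) * (1 / (1 - b * Real.exp (-x * h)) * E t) - x * (c - x) * E t := by
      rw [hm]; ring
    rw [h5]
    simp only [hE]
    linarith
  set κ := m / x with hκd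
  have hκx : x * κ = m := by rw [hκd]; field_simp
  have hκ1 : x - y < κ := by
    rw [← hκx] at hκ
    exact lt_of_mul_lt_mul_left hκ hx.le
  -- As `E' = -e^{-xt} φ`, the bound `hineq` says `E' + κ E ≤ K / x`, with integrating factor
  -- `e^{κt}`.
  have hanti : Antitone fun t => Real.exp (κ * t) * (E t - K / m) := by
    refine antitone_of_hasDerivAt_nonpos (fun t => (((hasDerivAt_id t).const_mul κ).exp).mul
      ((hasDerivAt_integral_Ioi (by have := H.contDiff.continuous; fun_prop) iφ t).sub_const _))
      fun t => ?_
    simp only [id, Pi.zero_apply]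
    have h1 := hineq t
    rw [← hκx] at h1
    have h2 : κ * E t - K / x - Real.exp (-x * t) * φ t ≤ 0 := by
      have : x * (κ * E t - K / x - Real.exp (-x * t) * φ t) ≤ 0 := by
        have : x * (K / x) = K := by field_simp
        linarith
      exact nonpos_of_mul_nonpos_right this hx
    have h3 : κ * (K / m) = K / x := by rw [hκd]; field_simp
    have := mul_nonpos_of_nonneg_of_nonpos (Real.exp_pos (κ * t)).le h2
    linear_combination this - Real.exp (κ * t) * h3
  have hub : ∀ s, E s ≤ C / (x - y) * Real.exp (-(x - y) * s) := by
    intro s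
    have h1 : E s ≤ ∫ r in Set.Ioi s, C * Real.exp ((y - x) * r) := by
      refine integral_mono (iφ s)
        ((integrableOn_exp_mul_Ioi (by linarith) s).const_mul C) fun r => ?_
      simp only
      rw [show (y - x) * r = y * r + -x * r by ring, Real.exp_add]
      have := mul_le_mul_of_nonneg_left (hφ r) (Real.exp_pos (-x * r)).le
      linarith
    refine h1.trans (le_of_eq ?_)
    rw [integral_const_mul, integral_exp_mul_Ioi (by linarith),
      show (y - x) = -(x - y) by ring, neg_div_neg_eq]
    ring
  -- At `-∞` the rate `y` allows `E` to grow at most like `e^{-(x - y)t}`; since `κ > x - y`, the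
  -- weight `e^{κt}` wins and the antitone function is nonpositive.
  have hE1 : ∀ t, E t ≤ K / m := by
    intro t
    have h1 : Tendsto (fun s => C / (x - y) * Real.exp ((κ - (x - y)) * s)) atBot
        (𝓝 (C / (x - y) * 0)) := by
      refine (Real.tendsto_exp_atBot.comp ?_).const_mul _
      exact tendsto_id.const_mul_atBot (by linarith)
    rw [mul_zero] at h1
    have h2 : Real.exp (κ * t) * (E t - K / m) ≤ 0 := by
      refine ge_of_tendsto h1 (eventually_atBot.2 ⟨t, fun s hs => (hanti hs).trans ?_⟩)
      simp only
      have h3 : E s - K / m ≤ C / (x - y) * Real.exp (-(x - y) * s) := by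
        have : 0 ≤ K / m := by positivity
        linarith [hub s]
      calc _ ≤ Real.exp (κ * s) * (C / (x - y) * Real.exp (-(x - y) * s)) :=
            mul_le_mul_of_nonneg_left h3 (Real.exp_pos _).le
        _ = _ := by
          rw [show (κ - (x - y)) * s = κ * s + -(x - y) * s by ring, Real.exp_add]; ring
    linarith [nonpos_of_mul_nonpos_right h2 (Real.exp_pos _)]
  refine ⟨x * (K / m), fun t => ?_⟩
  -- Monotonicity of `φ` converts the bound on the tail integral into a pointwise one.
  have h1 : φ t * (Real.exp (-x * t) / x) ≤ E t := by
    have h2 : ∫ s in Set.Ioi t, φ t * Real.exp (-x * s) = φ t * (Real.exp (-x * t) / x) := by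
      rw [integral_const_mul, integral_exp_mul_Ioi (by linarith), neg_div_neg_eq]
    rw [← h2]
    refine setIntegral_mono_on ((integrableOn_exp_mul_Ioi (by linarith) t).const_mul _) (iφ t)
      measurableSet_Ioi fun s hs => ?_
    have := mul_le_mul_of_nonneg_left (H.mono (Set.mem_Ioi.1 hs).le) (Real.exp_pos (-x * s)).le
    linarith
  have h2 := h1.trans (hE1 t)
  have h3 := mul_le_mul_of_nonneg_left h2 (mul_nonneg hx.le (Real.exp_pos (x * t)).le)
  have h4 : x * Real.exp (x * t) * (φ t * (Real.exp (-x * t) / x)) = φ t := by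
    have : Real.exp (x * t) * Real.exp (-x * t) = 1 := by
      rw [← Real.exp_add]; simp
    calc _ = φ t * (Real.exp (x * t) * Real.exp (-x * t)) * (x / x) := by ring
      _ = φ t := by rw [this, div_self hx.ne', mul_one, mul_one]
  linarith

/-- Start of the bootstrap, from rate 0. Far to the left `ψ ≤ 1/2`, so the nonlinearity takes at
most half of the linear term (`θ = 1/2`), and `G` carries the rest. The choice `cx = 1/4` stays
below the remaining `1/2`. -/
theorem exists_exp_bound (H : IsMonotoneFront b c h φ ψ) :
    ∃ x > 0, ∃ C, ∀ t, φ t ≤ C * Real.exp (x * t) := by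
  obtain ⟨t₀, ht₀⟩ : ∃ t₀, ∀ t ≤ t₀, ψ t ≤ 1 / 2 := by
    have := H.tendsto_psi_atBot.eventually (Iic_mem_nhds (show (0 : ℝ) < 1 / 2 by norm_num))
    exact eventually_atBot.1 this
  have hx : 0 < 1 / (4 * c) := by have := H.c_pos; positivity
  set x := 1 / (4 * c) with hxd
  refine ⟨x, hx, ?_⟩
  have iψ := integrableOn_Ioi_exp_mul_of_le H.continuous_psi H.abs_psi_le hx t₀
  refine H.growth_improve (y := 0) (C := 1) (θ := 1 / 2)
    (G := (Set.Ioi t₀).indicator fun s => Real.exp (-x * s) * ψ s) hx hx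
    (fun t => by simpa using H.le_one t) (by norm_num)
    (iψ.integrable_indicator measurableSet_Ioi) (fun s => ?_) (fun s => ?_) ?_
  · exact Set.indicator_nonneg (fun s _ => mul_nonneg (Real.exp_pos _).le (H.psi_nonneg s)) s
  · have he := Real.exp_pos (-x * s)
    by_cases hs : s ≤ t₀
    · rw [Set.indicator_of_notMem (by simpa using hs), add_zero]
      have h1 : ψ (s - h) ≤ 1 / 2 := ht₀ _ (by linarith [H.h_nonneg])
      have h2 : (1 - b) * ψ s * ψ (s - h) ≤ 1 / 2 * ψ s := by
        have h3 : (1 - b) * ψ s ≤ ψ s := by nlinarith [H.psi_nonneg s, H.b_nonneg]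
        nlinarith [H.psi_nonneg s, H.psi_nonneg (s - h)]
      have := mul_le_mul_of_nonneg_left h2 he.le
      linarith
    · rw [Set.indicator_of_mem (by simpa using hs)]
      have := mul_le_mul_of_nonneg_left (H.quadratic_le_psi s) he.le
      have := mul_nonneg he.le (H.psi_nonneg s)
      linarith
  · have h1 : 1 ≤ 1 / (1 - b * Real.exp (-x * h)) := by
      rw [le_div_iff₀ (H.one_sub_pos hx.le)]
      have := mul_nonneg H.b_nonneg (Real.exp_pos (-x * h)).le
      linarith
    have h2 : c * x = 1 / 4 := by
      rw [hxd]; have := H.c_pos; field_simp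
    nlinarith

theorem exp_bound_of_chiReal_pos (H : IsMonotoneFront b c h φ ψ) {x₁ : ℝ} (hx₁ : 0 < x₁)
    (hpos : ∀ x ∈ Set.Icc 0 x₁, 0 < chiReal b c h x) :
    ∃ C, ∀ t, φ t ≤ C * Real.exp (x₁ * t) := by
  obtain ⟨δ, hδ, C₀, hC₀⟩ := H.exists_exp_bound
  have hcont : ContinuousOn (chiReal b c h) (Set.Icc 0 x₁) := by
    unfold chiReal
    refine ContinuousOn.add (by fun_prop) (ContinuousOn.div (by fun_prop) (by fun_prop) ?_)
    exact fun x hx => (H.one_sub_pos hx.1).ne'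
  obtain ⟨xm, hxm, hmin⟩ := isCompact_Icc.exists_isMinOn (Set.nonempty_Icc.2 hx₁.le) hcont
  set m := chiReal b c h xm
  have hm : 0 < m := hpos xm hxm
  -- A uniform step: `η ≤ δ / 2` keeps the new rate below twice the old one, so `N` stays
  -- integrable, and `x₁ η ≤ m / 2` secures the gap required by `growth_improve`.
  set η := min (δ / 2) (m / (2 * x₁)) with hη
  have hη0 : 0 < η := lt_min (by positivity) (by positivity)
  have hηδ : η ≤ δ / 2 := min_le_left _ _
  have hηm : x₁ * η ≤ m / 2 := by
    have h1 : η ≤ m / (2 * x₁) := min_le_right _ _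
    have h2 := mul_le_mul_of_nonneg_left h1 hx₁.le
    have h3 : x₁ * (m / (2 * x₁)) = m / 2 := by field_simp
    linarith
  have key : ∀ n : ℕ, ∃ C, ∀ t, φ t ≤ C * Real.exp (min (δ + n * η) x₁ * t) := by
    intro n
    induction n with
    | zero => exact H.le_exp_of_le (by positivity) (by simp) hC₀
    | succ n ih =>
      set y := min (δ + n * η) x₁ with hy
      set x := min (δ + (n + 1 : ℕ) * η) x₁ with hx
      have hnη : 0 ≤ n * η := by positivity
      have hcast : ((n + 1 : ℕ) : ℝ) * η = n * η + η := by push_cast; ring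
      have hyx : y ≤ x := min_le_min_right _ (by rw [hcast]; linarith)
      rcases hyx.eq_or_lt with heq | hlt
      · rw [← heq]; exact ih
      · obtain ⟨C, hC⟩ := ih
        have hyX : y < x₁ := hlt.trans_le (min_le_right _ _)
        have hyδ : y = δ + n * η := by
          rcases min_choice (δ + n * η) x₁ with h1 | h1
          · exact h1
          · exact absurd (hy.trans h1) hyX.ne
        have hxy : x ≤ y + η := by
          rw [hyδ]; exact (min_le_left _ _).trans (by rw [hcast]; linarith)
        have hxX : x ≤ x₁ := min_le_right _ _
        have hy0 : 0 < y := by rw [hyδ]; linarith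
        obtain ⟨C', hC'⟩ := H.quadratic_le_exp hy0.le hC
        refine H.growth_improve (θ := 0) (y := y) (hy0.trans hlt) hlt hC zero_le_one
          (integrable_exp_mul_of_le H.continuous_quadratic H.abs_quadratic_le hC'
            (hy0.trans hlt) (by linarith))
          (fun s => mul_nonneg (Real.exp_pos _).le (H.quadratic_pos s).le)
          (fun s => by simp) ?_
        have h1 : m ≤ chiReal b c h x := hmin ⟨(hy0.trans hlt).le, hxX⟩
        have h2 : x * (x - y) ≤ x₁ * η :=
          mul_le_mul hxX (by linarith) (by linarith) hx₁.le
        rw [sub_zero, one_mul]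
        unfold chiReal at h1
        linarith
  obtain ⟨n, hn⟩ := exists_nat_ge (x₁ / η)
  have h1 : min (δ + n * η) x₁ = x₁ := min_eq_right (by
    rw [div_le_iff₀ hη0] at hn; linarith)
  simpa [h1] using key n

/-- Otherwise `χ₀ > 0` up to `c + 1`, giving `φ = O(e^{(c+1)t})`, while `e^{-ct} φ` is antitone and
positive. -/
theorem exists_chiReal_nonpos (H : IsMonotoneFront b c h φ ψ) :
    ∃ x ∈ Set.Icc 0 c, chiReal b c h x ≤ 0 := by
  by_contra! hpos
  have hc := H.c_pos
  obtain ⟨C, hC⟩ := H.exp_bound_of_chiReal_pos (x₁ := c + 1) (by linarith) fun x hx => by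
    rcases le_total x c with hxc | hxc
    · exact hpos x ⟨hx.1, hxc⟩
    · have h1 : 0 < 1 / (1 - b * Real.exp (-x * h)) := one_div_pos.2 (H.one_sub_pos hx.1)
      have h2 : 0 ≤ x * (x - c) := mul_nonneg hx.1 (by linarith)
      unfold chiReal
      linarith
  have h1 : ∀ t ≤ 0, φ 0 ≤ C * Real.exp t := fun t ht => by
    have h2 := H.antitone_exp_mul ht
    simp only [mul_zero, Real.exp_zero, one_mul] at h2
    refine h2.trans ?_
    have := mul_le_mul_of_nonneg_left (hC t) (Real.exp_pos (-c * t)).le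
    refine this.trans (le_of_eq ?_)
    rw [mul_left_comm, ← Real.exp_add]
    ring_nf
  have h2 : Tendsto (fun t => C * Real.exp t) atBot (𝓝 (C * 0)) :=
    Real.tendsto_exp_atBot.const_mul C
  have h3 := ge_of_tendsto h2 (eventually_atBot.2 ⟨0, h1⟩)
  linarith [H.pos 0]

end IsMonotoneFront

/-! ### Real zeros of the characteristic function. -/

section RealCharacteristic

variable {b c h : ℝ}

theorem one_sub_mul_exp_pos (hb0 : 0 ≤ b) (hb1 : b < 1) (hh : 0 ≤ h) {x : ℝ} (hx : 0 ≤ x) :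
    0 < 1 - b * Real.exp (-x * h) := by
  have h1 : Real.exp (-x * h) ≤ 1 := Real.exp_le_one_iff.2 (by nlinarith)
  nlinarith [Real.exp_pos (-x * h)]

/-- The derivative of `chiReal`. -/
noncomputable def chiRealDeriv (b c h x : ℝ) : ℝ :=
  2 * x - c - h * (b * Real.exp (-x * h)) / (1 - b * Real.exp (-x * h)) ^ 2

theorem hasDerivAt_chiReal (hb0 : 0 ≤ b) (hb1 : b < 1) (hh : 0 ≤ h) {x : ℝ} (hx : 0 ≤ x) :
    HasDerivAt (chiReal b c h) (chiRealDeriv b c h x) x := by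
  have h0 := (one_sub_mul_exp_pos hb0 hb1 hh hx).ne'
  have h1 := (((((hasDerivAt_id x).neg.mul_const h).exp).const_mul b).const_sub 1).inv h0
  have h2 := (((hasDerivAt_id x).pow 2).sub ((hasDerivAt_id x).const_mul c)).add h1
  have h3 : chiReal b c h = fun x => x ^ 2 - c * x + (1 - b * Real.exp (-x * h))⁻¹ := by
    funext x; simp [chiReal]
  rw [h3]
  refine h2.congr_deriv ?_
  simp only [chiRealDeriv, id, Pi.neg_apply]
  ring

theorem continuousOn_chiReal (hb0 : 0 ≤ b) (hb1 : b < 1) (hh : 0 ≤ h) :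
    ContinuousOn (chiReal b c h) (Set.Ici 0) := fun _ hx =>
  (hasDerivAt_chiReal hb0 hb1 hh hx).continuousAt.continuousWithinAt

/-- This strict convexity, combined with Rolle's theorem, excludes a third positive zero. -/
theorem chiRealDeriv_strictMono (hb0 : 0 ≤ b) (hb1 : b < 1) (hh : 0 ≤ h) {x y : ℝ} (hx : 0 ≤ x)
    (hxy : x < y) : chiRealDeriv b c h x < chiRealDeriv b c h y := by
  unfold chiRealDeriv
  have hX := one_sub_mul_exp_pos hb0 hb1 hh hx
  have hY := one_sub_mul_exp_pos hb0 hb1 hh (hx.trans hxy.le)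
  have he : b * Real.exp (-y * h) ≤ b * Real.exp (-x * h) :=
    mul_le_mul_of_nonneg_left (Real.exp_le_exp.2 (by nlinarith)) hb0
  have h1 : h * (b * Real.exp (-y * h)) / (1 - b * Real.exp (-y * h)) ^ 2
      ≤ h * (b * Real.exp (-x * h)) / (1 - b * Real.exp (-x * h)) ^ 2 := by
    have := mul_nonneg hb0 (Real.exp_pos (-x * h)).le
    gcongr
  linarith

theorem exists_chiRealDeriv_eq_zero (hb0 : 0 ≤ b) (hb1 : b < 1) (hh : 0 ≤ h) {x y : ℝ}
    (hx : 0 ≤ x) (hxy : x < y) (h1 : chiReal b c h x = 0) (h2 : chiReal b c h y = 0) :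
    ∃ ξ ∈ Set.Ioo x y, chiRealDeriv b c h ξ = 0 :=
  exists_hasDerivAt_eq_zero hxy
    ((continuousOn_chiReal hb0 hb1 hh).mono fun _ hz => hx.trans hz.1) (h1.trans h2.symm)
    fun _ hz => hasDerivAt_chiReal hb0 hb1 hh (hx.trans hz.1.le)

theorem exists_zeros_chiReal (hb0 : 0 ≤ b) (hb1 : b < 1) (hh : 0 ≤ h)
    (hex : ∃ x ∈ Set.Icc 0 c, chiReal b c h x ≤ 0) :
    ∃ l₂ l₁ : ℝ, 0 < l₂ ∧ l₂ ≤ l₁ ∧ l₂ < c ∧ (∀ x, 0 ≤ x → x < l₂ → 0 < chiReal b c h x) ∧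
      chiReal b c h l₂ = 0 ∧ chiReal b c h l₁ = 0 ∧
      (∀ x, 0 < x → chiReal b c h x = 0 → x = l₂ ∨ x = l₁) ∧
      (l₂ < l₁ → chiRealDeriv b c h l₂ < 0 ∧ 0 < chiRealDeriv b c h l₁) ∧
      (l₂ = l₁ → chiRealDeriv b c h l₂ = 0) := by
  have hcont := continuousOn_chiReal (c := c) hb0 hb1 hh
  have hcpt : IsCompact (Set.Icc 0 c ∩ chiReal b c h ⁻¹' Set.Iic 0) :=
    isCompact_Icc.of_isClosed_subset
      ((hcont.mono fun _ hz => hz.1).preimage_isClosed_of_isClosed isClosed_Icc isClosed_Iic)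
      Set.inter_subset_left
  obtain ⟨x₀, hx₀, hx₀'⟩ := hex
  -- The least point where `χ₀ ≤ 0` is the smaller zero. The sign of the derivative there decides
  -- between a double zero and a dip below 0 followed by a second zero before `c`.
  obtain ⟨l₂, ⟨⟨hl0, hlc⟩, hl2⟩, hleast⟩ := hcpt.exists_isLeast ⟨x₀, hx₀, hx₀'⟩
  have hg : ∀ x, 0 ≤ x → 0 < 1 / (1 - b * Real.exp (-x * h)) := fun x hx =>
    one_div_pos.2 (one_sub_mul_exp_pos hb0 hb1 hh hx)
  have hl2' : chiReal b c h l₂ ≤ 0 := hl2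
  have hl2pos : 0 < l₂ := by
    refine hl0.lt_of_ne' fun h0 => ?_
    have := hg 0 le_rfl
    rw [h0] at hl2'
    unfold chiReal at hl2'
    linarith
  have hchic : 0 < chiReal b c h c := by
    have := hg c (hl0.trans hlc)
    unfold chiReal
    linarith
  have hl2c : l₂ < c := hlc.lt_of_ne fun h0 => by rw [h0] at hl2'; linarith
  have hpos : ∀ x, 0 ≤ x → x < l₂ → 0 < chiReal b c h x := by
    intro x hx hxl
    by_contra! h0
    exact absurd (hleast ⟨⟨hx, hxl.le.trans hlc⟩, h0⟩) (not_le.2 hxl)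
  have hd := hasDerivAt_chiReal (c := c) hb0 hb1 hh hl0
  have hzero : chiReal b c h l₂ = 0 := by
    refine le_antisymm hl2' ?_
    have ht : Tendsto (chiReal b c h) (𝓝[<] l₂) (𝓝 (chiReal b c h l₂)) :=
      hd.continuousAt.tendsto.mono_left nhdsWithin_le_nhds
    refine ge_of_tendsto ht ?_
    filter_upwards [Ioo_mem_nhdsLT hl2pos] with x hx
    exact (hpos x hx.1.le hx.2).le
  have hdle : chiRealDeriv b c h l₂ ≤ 0 := by
    have ht := (hasDerivWithinAt_iff_tendsto_slope' Set.self_notMem_Iio).1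
      (hd.hasDerivWithinAt (s := Set.Iio l₂))
    refine le_of_tendsto ht ?_
    filter_upwards [Ioo_mem_nhdsLT hl2pos] with x hx
    rw [slope_def_field, hzero, sub_zero]
    exact div_nonpos_of_nonneg_of_nonpos (hpos x hx.1.le hx.2).le (by linarith [hx.2])
  rcases hdle.eq_or_lt with hd0 | hdneg
  · refine ⟨l₂, l₂, hl2pos, le_rfl, hl2c, hpos, hzero, hzero, ?_, fun h0 => absurd h0 (lt_irrefl _),
      fun _ => hd0⟩
    intro x hx hx0
    rcases lt_trichotomy x l₂ with hlt | heq | hgt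
    · exact absurd hx0 (hpos x hx.le hlt).ne'
    · exact Or.inl heq
    · obtain ⟨ξ, hξ, hξ0⟩ := exists_chiRealDeriv_eq_zero hb0 hb1 hh hl0 hgt hzero hx0
      have := chiRealDeriv_strictMono (c := c) hb0 hb1 hh hl0 hξ.1
      linarith
  · obtain ⟨x, hx, hxneg⟩ : ∃ x ∈ Set.Ioo l₂ c, chiReal b c h x < 0 := by
      by_contra! h0
      have ht := (hasDerivWithinAt_iff_tendsto_slope' Set.self_notMem_Ioi).1
        (hd.hasDerivWithinAt (s := Set.Ioi l₂))
      have : 0 ≤ chiRealDeriv b c h l₂ := by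
        refine ge_of_tendsto ht ?_
        filter_upwards [Ioo_mem_nhdsGT hl2c] with x hx
        rw [slope_def_field, hzero, sub_zero]
        exact div_nonneg (h0 x hx) (by linarith [hx.1])
      linarith
    obtain ⟨l₁, hl1, hl10⟩ := intermediate_value_Icc hx.2.le
      (hcont.mono fun z (hz : z ∈ Set.Icc x c) => (hl0.trans hx.1.le).trans hz.1)
      ⟨hxneg.le, hchic.le⟩
    have hlt : l₂ < l₁ := hx.1.trans_le hl1.1
    obtain ⟨ξ, hξ, hξ0⟩ := exists_chiRealDeriv_eq_zero hb0 hb1 hh hl0 hlt hzero hl10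
    have hdl1 : 0 < chiRealDeriv b c h l₁ := by
      have := chiRealDeriv_strictMono (c := c) hb0 hb1 hh (hl0.trans hξ.1.le) hξ.2
      linarith
    refine ⟨l₂, l₁, hl2pos, hlt.le, hl2c, hpos, hzero, hl10, ?_, fun _ => ⟨hdneg, hdl1⟩,
      fun h0 => absurd h0 hlt.ne⟩
    intro y hy hy0
    by_contra! hne
    rcases lt_or_gt_of_ne hne.1 with h1 | h1
    · exact (hpos y hy.le h1).ne' hy0
    rcases lt_or_gt_of_ne hne.2 with h2 | h2
    · obtain ⟨ζ, hζ, hζ0⟩ := exists_chiRealDeriv_eq_zero hb0 hb1 hh hl0 h1 hzero hy0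
      obtain ⟨ζ', hζ', hζ0'⟩ := exists_chiRealDeriv_eq_zero hb0 hb1 hh hy.le h2 hy0 hl10
      have := chiRealDeriv_strictMono (c := c) hb0 hb1 hh (hl0.trans hζ.1.le) (hζ.2.trans hζ'.1)
      linarith
    · obtain ⟨ζ', hζ', hζ0'⟩ := exists_chiRealDeriv_eq_zero hb0 hb1 hh (hl0.trans hlt.le) h2 hl10 hy0
      have := chiRealDeriv_strictMono (c := c) hb0 hb1 hh (hl0.trans hξ.1.le) (hξ.2.trans hζ'.1)
      linarith

end RealCharacteristic

/-! ### Complex zeros: multiplicities and a zero-free strip. -/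

section ComplexCharacteristic

variable {b c τ : ℝ}

theorem norm_mul_cexp (hb0 : 0 ≤ b) (z : ℂ) :
    ‖(b : ℂ) * Complex.exp (-z * c * τ)‖ = b * Real.exp (-z.re * (c * τ)) := by
  rw [norm_mul, Complex.norm_real, Real.norm_of_nonneg hb0, Complex.norm_exp]
  congr 2
  rw [mul_assoc, ← Complex.ofReal_mul, Complex.re_mul_ofReal, Complex.neg_re]

theorem le_norm_one_sub_mul_cexp (hb0 : 0 ≤ b) (z : ℂ) :
    1 - b * Real.exp (-z.re * (c * τ)) ≤ ‖1 - (b : ℂ) * Complex.exp (-z * c * τ)‖ := by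
  have := norm_sub_norm_le (1 : ℂ) ((b : ℂ) * Complex.exp (-z * c * τ))
  rwa [norm_mul_cexp hb0, norm_one] at this

theorem one_sub_mul_cexp_ne_zero (hb0 : 0 ≤ b) (hb1 : b < 1) (hh : 0 ≤ c * τ) {z : ℂ}
    (hz : 0 ≤ z.re) : 1 - (b : ℂ) * Complex.exp (-z * c * τ) ≠ 0 :=
  norm_pos_iff.1 ((one_sub_mul_exp_pos hb0 hb1 hh hz).trans_le (le_norm_one_sub_mul_cexp hb0 z))

theorem norm_delay_term_le (hb0 : 0 ≤ b) (hb1 : b < 1) (hh : 0 ≤ c * τ) {z : ℂ}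
    (hz : 0 ≤ z.re) : ‖1 / (1 - (b : ℂ) * Complex.exp (-z * c * τ))‖
      ≤ 1 / (1 - b * Real.exp (-z.re * (c * τ))) := by
  rw [norm_div, norm_one]
  exact one_div_le_one_div_of_le (one_sub_mul_exp_pos hb0 hb1 hh hz)
    (le_norm_one_sub_mul_cexp hb0 z)

theorem chi0_ofReal (x : ℝ) : chi0 b c τ x = (chiReal b c (c * τ) x : ℝ) := by
  unfold chi0 chiReal
  push_cast
  ring_nf

/-- The derivative of `chi0`. -/
noncomputable def chi0Deriv (b c τ : ℝ) (z : ℂ) : ℂ :=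
  2 * z - c - c * τ * (b * Complex.exp (-z * c * τ)) / (1 - b * Complex.exp (-z * c * τ)) ^ 2

theorem chi0Deriv_ofReal (x : ℝ) :
    chi0Deriv b c τ x = (chiRealDeriv b c (c * τ) x : ℝ) := by
  unfold chi0Deriv chiRealDeriv
  push_cast
  ring_nf

theorem hasDerivAt_chi0 (hb0 : 0 ≤ b) (hb1 : b < 1) (hh : 0 ≤ c * τ) {z : ℂ} (hz : 0 ≤ z.re) :
    HasDerivAt (chi0 b c τ) (chi0Deriv b c τ z) z := by
  have h0 := one_sub_mul_cexp_ne_zero hb0 hb1 hh hz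
  have h1 := ((((((hasDerivAt_id z).neg.mul_const (c : ℂ)).mul_const (τ : ℂ)).cexp).const_mul
    (b : ℂ)).const_sub 1).inv h0
  have h2 := (((hasDerivAt_id z).pow 2).sub ((hasDerivAt_id z).const_mul (c : ℂ))).add h1
  have h3 : chi0 b c τ = fun z => z ^ 2 - c * z + (1 - b * Complex.exp (-z * c * τ))⁻¹ := by
    funext x; simp [chi0]
  rw [h3]
  refine h2.congr_deriv ?_
  simp only [chi0Deriv, id, Pi.neg_apply]
  ring

theorem hasDerivAt_chi0Deriv (hb0 : 0 ≤ b) (hb1 : b < 1) (hh : 0 ≤ c * τ) {z : ℂ}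
    (hz : 0 ≤ z.re) :
    HasDerivAt (chi0Deriv b c τ)
      (2 + (c * τ) ^ 2 * (b * Complex.exp (-z * c * τ)) * (1 + b * Complex.exp (-z * c * τ))
        / (1 - b * Complex.exp (-z * c * τ)) ^ 3) z := by
  have h0 := one_sub_mul_cexp_ne_zero hb0 hb1 hh hz
  have hs := (((((hasDerivAt_id z).neg.mul_const (c : ℂ)).mul_const (τ : ℂ)).cexp).const_mul (b : ℂ))
  have h1 := (hs.const_mul ((c : ℂ) * τ)).div ((hs.const_sub 1).pow 2) (pow_ne_zero 2 h0)
  have h2 := (((hasDerivAt_id z).const_mul (2 : ℂ)).sub_const (c : ℂ)).sub h1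
  refine h2.congr_deriv ?_
  simp only [id, Pi.neg_apply, Pi.pow_apply]
  generalize Complex.exp (-z * c * τ) = e at h0 ⊢
  field_simp
  ring

theorem analyticAt_chi0 (hb0 : 0 ≤ b) (hb1 : b < 1) (hh : 0 ≤ c * τ) {z : ℂ} (hz : 0 < z.re) :
    AnalyticAt ℂ (chi0 b c τ) z :=
  DifferentiableOn.analyticAt (s := {z | 0 < z.re})
    (fun _ hw => (hasDerivAt_chi0 hb0 hb1 hh hw.le).differentiableAt.differentiableWithinAt)
    ((isOpen_lt continuous_const Complex.continuous_re).mem_nhds hz)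

theorem analyticOrderAt_chi0_of_deriv_ne_zero (hb0 : 0 ≤ b) (hb1 : b < 1) (hh : 0 ≤ c * τ) {x : ℝ}
    (hx : 0 < x) (h0 : chiReal b c (c * τ) x = 0) (h1 : chiRealDeriv b c (c * τ) x ≠ 0) :
    analyticOrderAt (chi0 b c τ) x = 1 := by
  have hx' : 0 < (x : ℂ).re := hx
  refine (analyticAt_chi0 hb0 hb1 hh hx').analyticOrderAt_eq_one_of_zero_deriv_ne_zero ?_ ?_
  · rw [chi0_ofReal, h0, Complex.ofReal_zero]
  · rw [(hasDerivAt_chi0 hb0 hb1 hh hx'.le).deriv, chi0Deriv_ofReal]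
    exact_mod_cast h1

theorem analyticOrderAt_chi0_of_deriv_eq_zero (hb0 : 0 ≤ b) (hb1 : b < 1) (hh : 0 ≤ c * τ) {x : ℝ}
    (hx : 0 < x) (h0 : chiReal b c (c * τ) x = 0) (h1 : chiRealDeriv b c (c * τ) x = 0) :
    analyticOrderAt (chi0 b c τ) x = 2 := by
  have hx' : 0 < (x : ℂ).re := hx
  have han := analyticAt_chi0 hb0 hb1 hh hx'
  have heq : deriv (chi0 b c τ) =ᶠ[𝓝 (x : ℂ)] chi0Deriv b c τ := by
    filter_upwards [(isOpen_lt continuous_const Complex.continuous_re).mem_nhds hx'] with z hz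
    exact (hasDerivAt_chi0 hb0 hb1 hh (le_of_lt hz)).deriv
  have hord : analyticOrderAt (deriv (chi0 b c τ)) x = 1 := by
    refine han.deriv.analyticOrderAt_eq_one_of_zero_deriv_ne_zero ?_ ?_
    · rw [heq.eq_of_nhds, chi0Deriv_ofReal, h1, Complex.ofReal_zero]
    · rw [heq.deriv_eq, (hasDerivAt_chi0Deriv hb0 hb1 hh hx'.le).deriv]
      -- The second derivative is positive on the positive real axis, so the order is at most 2.
      have hpos : 0 < 2 + (c * τ) ^ 2 * (b * Real.exp (-x * c * τ)) *
          (1 + b * Real.exp (-x * c * τ)) / (1 - b * Real.exp (-x * c * τ)) ^ 3 := by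
        have := one_sub_mul_exp_pos hb0 hb1 hh hx.le
        rw [← mul_assoc] at this
        positivity
      exact_mod_cast hpos.ne'
  have h2 := han.analyticOrderAt_deriv_add_one
  rw [hord, chi0_ofReal, h0, Complex.ofReal_zero] at h2
  simp only [sub_zero] at h2
  rw [← h2]
  norm_num

/-- On the line, the delay term has its largest modulus at the real point, whereas `|z (z - c)|`
exceeds its value there as soon as `Im z ≠ 0`; a zero requires the two moduli to agree. -/
theorem chi0_eq_zero_on_line (hb0 : 0 ≤ b) (hb1 : b < 1) (hh : 0 ≤ c * τ) {l : ℝ} (hl : 0 < l)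
    (h0 : chiReal b c (c * τ) l = 0) {z : ℂ} (hz : z.re = l) (hz0 : chi0 b c τ z = 0) :
    z = l := by
  have h1 := norm_delay_term_le hb0 hb1 hh (hl.le.trans hz.ge)
  have h2 : 1 / (1 - (b : ℂ) * Complex.exp (-z * c * τ)) = -(z * (z - c)) := by
    unfold chi0 at hz0
    linear_combination hz0
  have h3 : 1 / (1 - b * Real.exp (-l * (c * τ))) = l * (c - l) := by
    unfold chiReal at h0
    linarith
  rw [h2, hz, h3, norm_neg, norm_mul] at h1
  have h4 : (‖z‖ * ‖z - c‖) ^ 2 ≤ (l * (c - l)) ^ 2 :=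
    pow_le_pow_left₀ (by positivity) h1 2
  rw [mul_pow, Complex.sq_norm, Complex.sq_norm, Complex.normSq_apply, Complex.normSq_apply] at h4
  simp only [Complex.sub_re, Complex.sub_im, Complex.ofReal_re, Complex.ofReal_im, hz, sub_zero]
    at h4
  have h5 : 0 < l ^ 2 := by positivity
  have h6 : z.im ^ 2 * l ^ 2 ≤ 0 := by nlinarith [sq_nonneg (z.im * (l - c)), sq_nonneg (z.im ^ 2)]
  have h7 : z.im ^ 2 ≤ 0 := nonpos_of_mul_nonpos_left h6 h5
  have h8 : z.im = 0 := pow_eq_zero_iff two_ne_zero |>.1 (le_antisymm h7 (sq_nonneg _))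
  exact Complex.ext (by simpa using hz) (by simpa using h8)

/-- Used twice: to confine the zeros in a strip to a compact set, and to give `1 / χ₀` quadratic
decay along vertical lines. -/
theorem le_norm_chi0 (hb0 : 0 ≤ b) (hb1 : b < 1) (hh : 0 ≤ c * τ) {z : ℂ} (hz : 0 ≤ z.re) :
    z.im ^ 2 - (1 - b)⁻¹ ≤ ‖chi0 b c τ z‖ := by
  have h1 : ‖1 / (1 - (b : ℂ) * Complex.exp (-z * c * τ))‖ ≤ (1 - b)⁻¹ := by
    refine (norm_delay_term_le hb0 hb1 hh hz).trans ?_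
    rw [one_div]
    refine inv_anti₀ (by linarith) ?_
    have : Real.exp (-z.re * (c * τ)) ≤ 1 := Real.exp_le_one_iff.2 (by nlinarith)
    nlinarith
  have h2 : z.im ^ 2 ≤ ‖z * (z - c)‖ := by
    rw [norm_mul, ← sq_abs, sq]
    have h3 := Complex.abs_im_le_norm (z - c)
    simp only [Complex.sub_im, Complex.ofReal_im, sub_zero] at h3
    exact mul_le_mul (Complex.abs_im_le_norm z) h3 (abs_nonneg _) (norm_nonneg _)
  have h4 : z * (z - c) = chi0 b c τ z - 1 / (1 - (b : ℂ) * Complex.exp (-z * c * τ)) := by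
    unfold chi0; ring
  rw [h4] at h2
  linarith [norm_sub_le (chi0 b c τ z) (1 / (1 - (b : ℂ) * Complex.exp (-z * c * τ)))]

/-- A closed vertical strip around a real zero `l` of finite order that contains no other zero. -/
theorem exists_zero_free_strip (hb0 : 0 ≤ b) (hb1 : b < 1) (hh : 0 ≤ c * τ) {l : ℝ} (hl : 0 < l)
    (h0 : chiReal b c (c * τ) l = 0) (hord : analyticOrderAt (chi0 b c τ) l ≠ ⊤) :
    ∃ ε > 0, ε < l ∧ ∀ z : ℂ, |z.re - l| ≤ ε → chi0 b c τ z = 0 → z = l := by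
  have hiso : ∀ᶠ z in 𝓝[≠] (l : ℂ), chi0 b c τ z ≠ 0 :=
    (analyticAt_chi0 hb0 hb1 hh (z := (l : ℂ)) hl).eventually_eq_zero_or_eventually_ne_zero.resolve_left
      fun h1 => hord (analyticOrderAt_eq_top.2 h1)
  rw [eventually_nhdsWithin_iff] at hiso
  obtain ⟨U, hU, hUo, hlU⟩ := eventually_nhds_iff.1 hiso
  set M := Real.sqrt ((1 - b)⁻¹) with hM
  set R : Set ℂ := Set.Icc (l / 2) (2 * l) ×ℂ Set.Icc (-M) M with hR
  have hRc : IsCompact R := isCompact_Icc.reProdIm isCompact_Icc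
  have hcont : ContinuousOn (chi0 b c τ) R := fun z hz =>
    (hasDerivAt_chi0 hb0 hb1 hh (by
      have := (Complex.mem_reProdIm.1 hz).1.1
      linarith)).continuousAt.continuousWithinAt
  -- The other zeros near the line form a compact set, so `|Re z - l|` attains its minimum on it;
  -- `chi0_eq_zero_on_line` makes that minimum positive.
  have hK : IsCompact ((R ∩ chi0 b c τ ⁻¹' {0}) \ U) :=
    (hRc.of_isClosed_subset (hcont.preimage_isClosed_of_isClosed hRc.isClosed isClosed_singleton)
      Set.inter_subset_left).diff hUo
  have hmem : ∀ ε ≤ l / 2, ∀ z : ℂ, |z.re - l| ≤ ε → chi0 b c τ z = 0 → z ≠ l →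
      z ∈ (R ∩ chi0 b c τ ⁻¹' {0}) \ U := by
    intro ε hε z hz hz0 hzl
    have habs := abs_le.1 hz
    refine ⟨⟨Complex.mem_reProdIm.2 ⟨⟨by linarith, by linarith⟩, abs_le.1 ?_⟩, hz0⟩,
      fun hzU => hU z hzU hzl hz0⟩
    have h1 := le_norm_chi0 hb0 hb1 hh (z := z) (by linarith)
    rw [hz0, norm_zero] at h1
    exact Real.abs_le_sqrt (by linarith)
  rcases ((R ∩ chi0 b c τ ⁻¹' {0}) \ U).eq_empty_or_nonempty with hemp | hne
  · refine ⟨l / 2, by positivity, by linarith, fun z hz hz0 => ?_⟩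
    by_contra hzl
    have := hmem _ le_rfl z hz hz0 hzl
    rw [hemp] at this
    exact this
  · obtain ⟨w, hw, hmin⟩ := hK.exists_isMinOn hne
      (f := fun z : ℂ => |z.re - l|) (by fun_prop)
    have hwpos : 0 < |w.re - l| := by
      refine abs_pos.2 fun h1 => ?_
      have h2 := chi0_eq_zero_on_line hb0 hb1 hh hl h0 (z := w) (by linarith) hw.1.2
      exact hw.2 (h2 ▸ hlU)
    refine ⟨min (l / 2) (|w.re - l| / 2), by positivity,
      (min_le_left _ _).trans_lt (by linarith), fun z hz hz0 => ?_⟩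
    by_contra hzl
    have h1 : |w.re - l| ≤ |z.re - l| := hmin (hmem _ (min_le_left _ _) z hz hz0 hzl)
    linarith [hz.trans (min_le_right _ _)]

end ComplexCharacteristic

/-! ### Laplace transform: rules, analyticity, inversion and contour shift. -/

/-- The two-sided Laplace transform `∫ e^{-z t} f(t) dt`. -/
noncomputable def laplace (f : ℝ → ℝ) (z : ℂ) : ℂ :=
  ∫ t : ℝ, Complex.exp (-z * t) * f t

theorem integrable_cexp_mul {f : ℝ → ℝ} {z : ℂ}
    (hf : Integrable fun t => Real.exp (-z.re * t) * f t) :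
    Integrable fun t : ℝ => Complex.exp (-z * t) * f t := by
  have h1 := (hf.ofReal (𝕜 := ℂ)).bdd_mul (c := 1)
    (f := fun t : ℝ => Complex.exp ((-(z.im * t) : ℝ) * Complex.I))
    (by fun_prop) (Eventually.of_forall fun t => by rw [Complex.norm_exp_ofReal_mul_I])
  refine h1.congr (Eventually.of_forall fun t => ?_)
  simp only [RCLike.ofReal_mul, Complex.coe_algebraMap]
  rw [← mul_assoc, Complex.ofReal_exp, ← Complex.exp_add]
  congr 2
  push_cast
  linear_combination (-(t : ℂ)) * (Complex.re_add_im z)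

theorem norm_laplace_le {f : ℝ → ℝ} (z : ℂ) :
    ‖laplace f z‖ ≤ ∫ t, Real.exp (-z.re * t) * |f t| := by
  refine (norm_integral_le_integral_norm _).trans (le_of_eq ?_)
  congr 1
  funext t
  rw [norm_mul, Complex.norm_exp, Complex.norm_real, Real.norm_eq_abs]
  congr 2
  rw [Complex.re_mul_ofReal, Complex.neg_re]

theorem laplace_ofReal (f : ℝ → ℝ) (x : ℝ) :
    laplace f x = ((∫ t, Real.exp (-x * t) * f t : ℝ) : ℂ) := by
  unfold laplace
  rw [← integral_complex_ofReal]
  push_cast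
  rfl

theorem laplace_deriv {f f' : ℝ → ℝ} (hd : ∀ t, HasDerivAt f (f' t) t) {z : ℂ}
    (hf : Integrable fun t => Real.exp (-z.re * t) * f t)
    (hf' : Integrable fun t => Real.exp (-z.re * t) * f' t) :
    laplace f' z = z * laplace f z := by
  have i1 := integrable_cexp_mul hf
  have i2 := integrable_cexp_mul hf'
  have h1 : ∀ t : ℝ, HasDerivAt (fun t : ℝ => Complex.exp (-z * t) * f t)
      (Complex.exp (-z * t) * f' t - z * (Complex.exp (-z * t) * f t)) t := by
    intro t
    have h2 := (((Complex.ofRealCLM.hasDerivAt (x := t)).const_mul (-z)).cexp).mul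
      (hd t).ofReal_comp
    refine h2.congr_deriv ?_
    simp only [Complex.ofRealCLM_apply, Complex.ofReal_one]
    ring
  have h3 := integral_eq_zero_of_hasDerivAt_of_integrable h1 (i2.sub (i1.const_mul z)) i1
  rw [integral_sub i2 (i1.const_mul z), integral_const_mul] at h3
  exact sub_eq_zero.1 h3

theorem laplace_shift (f : ℝ → ℝ) (z : ℂ) (a : ℝ) :
    laplace (fun t => f (t - a)) z = Complex.exp (-z * a) * laplace f z := by
  unfold laplace
  rw [← integral_sub_right_eq_self (fun t : ℝ => Complex.exp (-z * t) * (f t : ℂ)) a,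
    ← integral_const_mul]
  congr 1
  funext t
  rw [← mul_assoc, ← Complex.exp_add]
  congr 2
  push_cast
  ring

/-- Nonnegativity makes `f` the density of a measure, so its transform is a complex moment
generating function, analytic over the interior of the integrability set. -/
theorem differentiableOn_laplace {f : ℝ → ℝ} (hf : Continuous f) (hf0 : ∀ t, 0 ≤ f t)
    {C₁ C₂ μ₁ μ₂ : ℝ} (h₁ : ∀ t, |f t| ≤ C₁ * Real.exp (μ₁ * t))
    (h₂ : ∀ t, |f t| ≤ C₂ * Real.exp (μ₂ * t)) :
    DifferentiableOn ℂ (laplace f) {z | μ₁ < z.re ∧ z.re < μ₂} := by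
  set ν : Measure ℝ := volume.withDensity fun t => ENNReal.ofReal (f t) with hν
  have hm : Measurable fun t => ENNReal.ofReal (f t) := hf.measurable.ennreal_ofReal
  have hlt : ∀ᵐ t : ℝ, ENNReal.ofReal (f t) < ⊤ :=
    Eventually.of_forall fun t => ENNReal.ofReal_lt_top
  have h3 : laplace f = ProbabilityTheory.complexMGF (fun t => -t) ν := by
    funext z
    unfold laplace ProbabilityTheory.complexMGF
    rw [hν, integral_withDensity_eq_integral_toReal_smul hm hlt]
    congr 1
    funext t
    rw [ENNReal.toReal_ofReal (hf0 t), Complex.real_smul, mul_comm]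
    push_cast
    ring_nf
  rw [h3]
  refine ProbabilityTheory.differentiableOn_complexMGF.mono fun z hz => ?_
  refine mem_interior.2 ⟨Set.Ioo μ₁ μ₂, fun x hx => ?_, isOpen_Ioo, hz⟩
  change Integrable (fun t => Real.exp (x * -t)) ν
  rw [hν, integrable_withDensity_iff_integrable_smul' hm hlt]
  refine (integrable_exp_mul_of_le hf h₁ h₂ hx.1 hx.2).congr (Eventually.of_forall fun t => ?_)
  simp only [ENNReal.toReal_ofReal (hf0 t), smul_eq_mul]
  rw [mul_comm, mul_neg, neg_mul]

section VerticalLine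

variable {K : ℂ → ℂ} {x₀ x₁ C : ℝ}

theorem integrable_of_norm_le_inv_one_add_sq {g : ℝ → ℂ} (hg : Continuous g)
    (hC : ∀ y, ‖g y‖ ≤ C * (1 + y ^ 2)⁻¹) : Integrable g :=
  (integrable_inv_one_add_sq.const_mul C).mono' hg.aestronglyMeasurable (Eventually.of_forall hC)

theorem continuous_vertical (hK : DifferentiableOn ℂ K (Complex.re ⁻¹' Set.Icc x₀ x₁)) {x : ℝ}
    (hx : x ∈ Set.Icc x₀ x₁) : Continuous fun y : ℝ => K (x + y * Complex.I) := by
  rw [← continuousOn_univ]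
  exact hK.continuousOn.comp (by fun_prop) fun y _ => by simpa using hx

/-- The integral over a vertical line is independent of the line. -/
theorem integral_vertical_eq (h01 : x₀ ≤ x₁)
    (hK : DifferentiableOn ℂ K (Complex.re ⁻¹' Set.Icc x₀ x₁))
    (hC : ∀ z : ℂ, z.re ∈ Set.Icc x₀ x₁ → ‖K z‖ ≤ C * (1 + z.im ^ 2)⁻¹) :
    ∫ y : ℝ, K (x₀ + y * Complex.I) = ∫ y : ℝ, K (x₁ + y * Complex.I) := by
  have hi : ∀ x ∈ Set.Icc x₀ x₁, Integrable fun y : ℝ => K (x + y * Complex.I) := fun x hx =>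
    integrable_of_norm_le_inv_one_add_sq (continuous_vertical hK hx) fun y => by
      simpa using hC (x + y * Complex.I) (by simpa using hx)
  have hv : ∀ x ∈ Set.Icc x₀ x₁, Tendsto (fun T : ℝ => ∫ y in (-T)..T, K (x + y * Complex.I)) atTop
      (𝓝 (∫ y : ℝ, K (x + y * Complex.I))) := fun x hx =>
    intervalIntegral_tendsto_integral (hi x hx) tendsto_neg_atTop_atBot tendsto_id
  have hsq : Tendsto (fun T : ℝ => C * (1 + T ^ 2)⁻¹ * |x₁ - x₀|) atTop (𝓝 0) := by
    have h1 : Tendsto (fun T : ℝ => 1 + T ^ 2) atTop atTop :=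
      tendsto_atTop_add_const_left _ _ (tendsto_pow_atTop two_ne_zero)
    simpa using (h1.inv_tendsto_atTop.const_mul C).mul_const |x₁ - x₀|
  -- The sign `s = ±1` treats the top and bottom edges of the rectangle together.
  have hh : ∀ s : ℝ, s ^ 2 = 1 →
      Tendsto (fun T : ℝ => ∫ x in x₀..x₁, K (x + (s * T : ℝ) * Complex.I)) atTop (𝓝 0) := by
    intro s hs
    refine squeeze_zero_norm (fun T => ?_) hsq
    refine intervalIntegral.norm_integral_le_of_norm_le_const fun x hx => ?_
    rw [Set.uIoc_of_le h01] at hx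
    have h2 := hC (x + (s * T : ℝ) * Complex.I) (by simpa using ⟨hx.1.le, hx.2⟩)
    have h3 : (x + (s * T : ℝ) * Complex.I : ℂ).im = s * T := by simp
    rwa [h3, mul_pow, hs, one_mul] at h2
  have hrect : ∀ T : ℝ, (∫ x in x₀..x₁, K (x + ((-1) * T : ℝ) * Complex.I))
      - (∫ x in x₀..x₁, K (x + (1 * T : ℝ) * Complex.I))
      + Complex.I * (∫ y in (-T)..T, K (x₁ + y * Complex.I))
      - Complex.I * (∫ y in (-T)..T, K (x₀ + y * Complex.I)) = 0 := by
    intro T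
    have h4 := Complex.integral_boundary_rect_eq_zero_of_differentiableOn K
      (x₀ + (-T : ℝ) * Complex.I) (x₁ + T * Complex.I) (hK.mono fun z hz => by
        have := (Complex.mem_reProdIm.1 hz).1
        simp only [Complex.add_re, Complex.ofReal_re, Complex.mul_re, Complex.I_re, mul_zero,
          Complex.ofReal_im, Complex.I_im, mul_one, sub_self, add_zero] at this
        rwa [Set.uIcc_of_le h01] at this)
    simpa [neg_one_mul] using h4
  have hlim := (((hh (-1) (by norm_num)).sub (hh 1 (by norm_num))).add
    ((hv x₁ ⟨h01, le_rfl⟩).const_mul Complex.I)).sub ((hv x₀ ⟨le_rfl, h01⟩).const_mul Complex.I)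
  have h5 := tendsto_nhds_unique (hlim.congr hrect) tendsto_const_nhds
  have h6 : Complex.I * ((∫ y : ℝ, K (x₁ + y * Complex.I)) - ∫ y : ℝ, K (x₀ + y * Complex.I)) = 0 := by
    linear_combination h5
  exact (sub_eq_zero.1 ((mul_eq_zero.1 h6).resolve_left Complex.I_ne_zero)).symm

end VerticalLine

theorem laplace_inversion {v : ℝ → ℝ} (hv : Continuous v) {x : ℝ}
    (hi : Integrable fun t => Real.exp (-x * t) * v t)
    (hL : Integrable fun y : ℝ => laplace v (x + y * Complex.I)) (t : ℝ) :
    (v t : ℂ) = (2 * Real.pi)⁻¹ *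
      ∫ y : ℝ, Complex.exp ((x + y * Complex.I) * t) * laplace v (x + y * Complex.I) := by
  set f : ℝ → ℂ := fun s => ((Real.exp (-x * s) * v s : ℝ) : ℂ) with hf
  -- The Fourier variable carries a factor `2π`, so inversion reduces to Fourier inversion for
  -- `e^{-xt} v(t)` after rescaling.
  have hfour : FourierTransform.fourier f
      = fun w : ℝ => laplace v (x + (2 * Real.pi * w : ℝ) * Complex.I) := by
    funext w
    rw [Real.fourier_real_eq_integral_exp_smul]
    unfold laplace
    congr 1
    funext s
    simp only [hf, smul_eq_mul, Complex.ofReal_mul, Complex.ofReal_exp]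
    rw [← mul_assoc, ← Complex.exp_add]
    congr 2
    push_cast
    ring
  have h2π : (0 : ℝ) < 2 * Real.pi := by positivity
  have hinv := MeasureTheory.Integrable.fourierInv_fourier_eq (f := f) (v := t)
    (hi.ofReal (𝕜 := ℂ))
    (by rw [hfour]; exact hL.comp_mul_left' h2π.ne')
    (by rw [hf]; exact (by fun_prop : Continuous f).continuousAt)
  rw [Real.fourierInv_eq', hfour] at hinv
  have h1 : (∫ w : ℝ, Complex.exp ((2 * Real.pi * inner ℝ w t : ℝ) * Complex.I) •
      laplace v (x + (2 * Real.pi * w : ℝ) * Complex.I))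
      = (2 * Real.pi)⁻¹ * ∫ y : ℝ, Complex.exp ((y * t) * Complex.I) *
        laplace v (x + y * Complex.I) := by
    have h2 := Measure.integral_comp_mul_left (fun y : ℝ => Complex.exp ((y * t) * Complex.I) *
        laplace v (x + y * Complex.I)) (2 * Real.pi)
    rw [abs_of_pos (inv_pos.2 h2π), Complex.real_smul] at h2
    push_cast at h2
    push_cast
    rw [← h2]
    congr 1
    funext w
    have h4 : inner ℝ w t = w * t := by simp [mul_comm]
    rw [h4, smul_eq_mul]
    push_cast
    ring_nf
  rw [h1] at hinv
  have h3 : (v t : ℂ) = Complex.exp (x * t) * f t := by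
    simp only [hf, Complex.ofReal_mul, Complex.ofReal_exp]
    rw [← mul_assoc, ← Complex.exp_add]
    simp
  rw [h3, ← hinv, mul_left_comm, ← integral_const_mul]
  congr 2
  funext y
  rw [← mul_assoc, ← Complex.exp_add]
  ring_nf

/-- If the Laplace transform of `v` on the line `Re z = x₀` extends analytically to the strip up to
`Re z = x₁`, with quadratic decay, then `v` is `O(e^{x₁ t})`. -/
theorem exp_bound_of_laplace_continuation {v : ℝ → ℝ} (hv : Continuous v) {x₀ x₁ C : ℝ}
    (h01 : x₀ ≤ x₁) (hi : Integrable fun t => Real.exp (-x₀ * t) * v t) {G : ℂ → ℂ}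
    (hG : DifferentiableOn ℂ G (Complex.re ⁻¹' Set.Icc x₀ x₁))
    (hC : ∀ z : ℂ, z.re ∈ Set.Icc x₀ x₁ → ‖G z‖ ≤ C * (1 + z.im ^ 2)⁻¹)
    (hL : ∀ y : ℝ, laplace v (x₀ + y * Complex.I) = G (x₀ + y * Complex.I)) :
    ∃ C', ∀ t, |v t| ≤ C' * Real.exp (x₁ * t) := by
  have hb : ∀ x ∈ Set.Icc x₀ x₁, ∀ y : ℝ, ‖G (x + y * Complex.I)‖ ≤ C * (1 + y ^ 2)⁻¹ :=
    fun x hx y => by simpa using hC (x + y * Complex.I) (by simpa using hx)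
  have hLi : Integrable fun y : ℝ => laplace v (x₀ + y * Complex.I) := by
    simp_rw [hL]
    exact integrable_of_norm_le_inv_one_add_sq (continuous_vertical hG ⟨le_rfl, h01⟩)
      (hb x₀ ⟨le_rfl, h01⟩)
  refine ⟨(2 * Real.pi)⁻¹ * (C * Real.pi), fun t => ?_⟩
  have h1 := laplace_inversion hv hi hLi t
  simp_rw [hL] at h1
  -- Here `t` is fixed, so a `t`-dependent constant is harmless: it only serves to move the line.
  -- The final bound is read off on `Re z = x₁`.
  have h2 := integral_vertical_eq (K := fun z => Complex.exp (z * t) * G z)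
    (C := max (Real.exp (x₀ * t)) (Real.exp (x₁ * t)) * C) h01
    (((Complex.differentiable_exp.comp (differentiable_id.mul_const _)).differentiableOn).mul hG)
    fun z hz => by
      rw [norm_mul, Complex.norm_exp, mul_assoc]
      refine mul_le_mul ?_ (hC z hz) (norm_nonneg _) (by positivity)
      rw [Complex.re_mul_ofReal]
      rcases le_total 0 t with ht | ht
      · exact le_max_of_le_right (Real.exp_le_exp.2 (mul_le_mul_of_nonneg_right hz.2 ht))
      · exact le_max_of_le_left (Real.exp_le_exp.2 (mul_le_mul_of_nonpos_right hz.1 ht))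
  rw [h2] at h1
  have h3 : ‖∫ y : ℝ, Complex.exp ((x₁ + y * Complex.I) * t) * G (x₁ + y * Complex.I)‖
      ≤ ∫ y : ℝ, Real.exp (x₁ * t) * (C * (1 + y ^ 2)⁻¹) := by
    refine norm_integral_le_of_norm_le ((integrable_inv_one_add_sq.const_mul C).const_mul _)
      (Eventually.of_forall fun y => ?_)
    rw [norm_mul, Complex.norm_exp, Complex.re_mul_ofReal]
    simp only [Complex.add_re, Complex.ofReal_re, Complex.mul_re, Complex.I_re, mul_zero,
      Complex.ofReal_im, Complex.I_im, mul_one, sub_self, add_zero]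
    exact mul_le_mul_of_nonneg_left (hb x₁ ⟨h01, le_rfl⟩ y) (Real.exp_pos _).le
  rw [integral_const_mul, integral_const_mul, integral_univ_inv_one_add_sq] at h3
  have h4 : |v t| = ‖(v t : ℂ)‖ := by rw [Complex.norm_real, Real.norm_eq_abs]
  have h5 : ‖(((2 * Real.pi)⁻¹ : ℝ) : ℂ)‖ = (2 * Real.pi)⁻¹ := by
    rw [Complex.norm_real, Real.norm_of_nonneg (by positivity)]
  rw [h4, h1, norm_mul, h5, mul_assoc]
  refine mul_le_mul_of_nonneg_left (h3.trans (le_of_eq (by ring))) (by positivity)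

theorem Integrable.exp_mul_of_abs_le {f g : ℝ → ℝ} {x C : ℝ} (hf : Continuous f)
    (hg : Integrable fun t => Real.exp (-x * t) * g t) (h : ∀ t, |f t| ≤ C * g t) :
    Integrable fun t => Real.exp (-x * t) * f t := by
  refine (hg.const_mul C).mono' (by fun_prop) (Eventually.of_forall fun t => ?_)
  rw [norm_mul, Real.norm_eq_abs, Real.abs_exp, Real.norm_eq_abs]
  have := mul_le_mul_of_nonneg_left (h t) (Real.exp_pos (-x * t)).le
  linarith

/-! ### The transformed equation and lower bounds for the decay of `φ`. -/

namespace IsMonotoneFront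

variable {b c τ : ℝ} {φ ψ : ℝ → ℝ}

theorem integrable_exp_mul (H : IsMonotoneFront b c (c * τ) φ ψ) {C μ x : ℝ}
    (hC : ∀ t, φ t ≤ C * Real.exp (μ * t)) (hx0 : 0 < x) (hxμ : x < μ) :
    Integrable fun t => Real.exp (-x * t) * φ t :=
  integrable_exp_mul_of_le H.contDiff.continuous H.abs_le
    (fun t => by rw [abs_of_nonneg (H.nonneg t)]; exact hC t) hx0 hxμ

theorem integrable_exp_mul_quadratic (H : IsMonotoneFront b c (c * τ) φ ψ) {C μ x : ℝ}
    (hC : ∀ t, φ t ≤ C * Real.exp (μ * t)) (hx0 : 0 < x) (hxμ : x < 2 * μ) :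
    Integrable fun t => Real.exp (-x * t) * ((1 - b) * ψ t * ψ (t - c * τ)) := by
  obtain ⟨C', hC'⟩ := H.quadratic_le_exp (by linarith) hC
  exact integrable_exp_mul_of_le H.continuous_quadratic H.abs_quadratic_le hC' hx0 hxμ

theorem laplace_identity (H : IsMonotoneFront b c (c * τ) φ ψ) {C μ : ℝ}
    (hC : ∀ t, φ t ≤ C * Real.exp (μ * t)) {z : ℂ} (hz0 : 0 < z.re) (hzμ : z.re < μ) :
    chi0 b c τ z * laplace φ z = laplace (fun t => (1 - b) * ψ t * ψ (t - c * τ)) z := by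
  have hμ : 0 < μ := hz0.trans hzμ
  have iφ := H.integrable_exp_mul hC hz0 hzμ
  have iψ : Integrable fun t => Real.exp (-z.re * t) * ψ t :=
    integrable_exp_mul_of_le H.continuous_psi H.abs_psi_le
      (fun t => by rw [abs_of_nonneg (H.psi_nonneg t)]; exact H.psi_le_exp hμ.le hC t) hz0 hzμ
  have iN := H.integrable_exp_mul_quadratic hC hz0 (by linarith : z.re < 2 * μ)
  have iφ' : Integrable fun t => Real.exp (-z.re * t) * deriv φ t :=
    Integrable.exp_mul_of_abs_le H.contDiff_deriv.continuous iφ fun t => by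
      rw [abs_of_nonneg (H.deriv_nonneg t)]; exact H.deriv_le t
  have heq : deriv (deriv φ) = fun t =>
      c * deriv φ t - ψ t + (1 - b) * ψ t * ψ (t - c * τ) := by
    funext t
    have := H.equation t
    linarith
  have iφ'' : Integrable fun t => Real.exp (-z.re * t) * deriv (deriv φ) t := by
    rw [heq]
    refine (((iφ'.const_mul c).sub iψ).add iN).congr (Eventually.of_forall fun t => ?_)
    simp only [Pi.add_apply, Pi.sub_apply]
    ring
  have h1 := laplace_deriv H.hasDerivAt iφ iφ'
  have h2 := laplace_deriv H.hasDerivAt_deriv iφ' iφ''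
  have h3 : laplace (deriv (deriv φ)) z = c * laplace (deriv φ) z - laplace ψ z
      + laplace (fun t => (1 - b) * ψ t * ψ (t - c * τ)) z := by
    have j1 := integrable_cexp_mul iφ'
    have j2 := integrable_cexp_mul iψ
    have j3 := integrable_cexp_mul iN
    rw [heq]
    unfold laplace
    have j12 : Integrable fun t : ℝ => c * (Complex.exp (-z * t) * deriv φ t)
        - Complex.exp (-z * t) * ψ t := (j1.const_mul _).sub j2
    rw [← integral_const_mul, ← integral_sub (j1.const_mul _) j2, ← integral_add j12 j3]
    congr 1
    funext t
    push_cast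
    ring
  have h4 : laplace ψ z = laplace φ z
      + b * (Complex.exp (-z * c * τ) * laplace ψ z) := by
    have j1 := integrable_cexp_mul iφ
    have hsh : Integrable fun t : ℝ => Complex.exp (-z * t) * (ψ (t - c * τ) : ℂ) := by
      refine integrable_cexp_mul (Integrable.exp_mul_of_abs_le (C := 1) ?_ iψ fun t => ?_)
      · have := H.continuous_psi
        fun_prop
      · rw [abs_of_nonneg (H.psi_nonneg _), one_mul]
        exact H.mono_psi (by linarith [H.h_nonneg])
    have h5 := laplace_shift ψ z (c * τ)
    have h6 : -z * ((c * τ : ℝ) : ℂ) = -z * c * τ := by push_cast; ring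
    rw [h6] at h5
    rw [← h5]
    unfold laplace
    rw [← integral_const_mul, ← integral_add j1 (hsh.const_mul _)]
    congr 1
    funext t
    conv_lhs => rw [H.psi_eq t]
    push_cast
    ring
  have h7 := one_sub_mul_cexp_ne_zero H.b_nonneg H.b_lt_one H.h_nonneg hz0.le
  have h8 : laplace ψ z = 1 / (1 - b * Complex.exp (-z * c * τ)) * laplace φ z := by
    rw [one_div, eq_inv_mul_iff_mul_eq₀ h7]
    linear_combination h4
  rw [h2, h1, h8] at h3
  unfold chi0
  linear_combination h3

theorem laplace_quadratic_pos (H : IsMonotoneFront b c (c * τ) φ ψ) {C μ x : ℝ}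
    (hC : ∀ t, φ t ≤ C * Real.exp (μ * t)) (hx0 : 0 < x) (hxμ : x < 2 * μ) :
    0 < (laplace (fun t => (1 - b) * ψ t * ψ (t - c * τ)) x).re := by
  rw [laplace_ofReal, Complex.ofReal_re]
  have hpos : ∀ t, 0 < Real.exp (-x * t) * ((1 - b) * ψ t * ψ (t - c * τ)) := fun t =>
    mul_pos (Real.exp_pos _) (H.quadratic_pos t)
  rw [integral_pos_iff_support_of_nonneg (fun t => (hpos t).le)
    (H.integrable_exp_mul_quadratic hC hx0 hxμ)]
  have : (Function.support fun t => Real.exp (-x * t) * ((1 - b) * ψ t * ψ (t - c * τ)))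
      = Set.univ := Set.eq_univ_of_forall fun t => (hpos t).ne'
  rw [this]
  simp

theorem differentiableOn_laplace_quadratic (H : IsMonotoneFront b c (c * τ) φ ψ) {C μ : ℝ}
    (hμ : 0 ≤ μ) (hC : ∀ t, φ t ≤ C * Real.exp (μ * t)) :
    DifferentiableOn ℂ (laplace fun t => (1 - b) * ψ t * ψ (t - c * τ))
      {z | 0 < z.re ∧ z.re < 2 * μ} := by
  obtain ⟨D, hD⟩ := H.quadratic_le_exp hμ hC
  exact differentiableOn_laplace H.continuous_quadratic (fun t => (H.quadratic_pos t).le)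
    H.abs_quadratic_le hD

/-- `φ` does not decay faster than the smallest positive zero of the characteristic function. -/
theorem not_exp_bound (H : IsMonotoneFront b c (c * τ) φ ψ) {C l μ : ℝ} (hl : 0 < l)
    (h0 : chiReal b c (c * τ) l = 0) (hlμ : l < μ) :
    ¬ ∀ t, φ t ≤ C * Real.exp (μ * t) := by
  intro hC
  -- If `φ̂` converged at `l`, the left side would vanish there, but `N̂(l) > 0`.
  have h1 := H.laplace_identity hC (z := l) hl hlμ
  have h2 := H.laplace_quadratic_pos hC hl (by linarith)
  rw [← h1, chi0_ofReal, h0] at h2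
  simp at h2

/-- The bound would give `φ̂(x) ≤ C / (l - x) + 1 / x` as `x ↑ l`. At a double zero `χ₀(x) = o(l -
x)`, so `N̂(x) = χ₀(x) φ̂(x)` would tend to 0, against `N̂(l) > 0`. -/
theorem not_exp_bound_of_double (H : IsMonotoneFront b c (c * τ) φ ψ) {C l : ℝ} (hl : 0 < l)
    (h0 : chiReal b c (c * τ) l = 0) (h1 : chiRealDeriv b c (c * τ) l = 0) :
    ¬ ∀ t, φ t ≤ C * Real.exp (l * t) := by
  intro hC
  set F : ℝ → ℝ := fun x => (laplace (fun t => (1 - b) * ψ t * ψ (t - c * τ)) x).re with hF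
  have hFl : 0 < F l := H.laplace_quadratic_pos hC hl (by linarith)
  have hFc : Tendsto F (𝓝[<] l) (𝓝 (F l)) := by
    have h2 : ContinuousAt (laplace fun t => (1 - b) * ψ t * ψ (t - c * τ)) (l : ℂ) := by
      refine ((H.differentiableOn_laplace_quadratic hl.le hC).differentiableAt
        (IsOpen.mem_nhds ?_ ⟨by simpa using hl, ?_⟩)).continuousAt
      · exact (isOpen_lt continuous_const Complex.continuous_re).inter
          (isOpen_lt Complex.continuous_re continuous_const)
      · simp only [Complex.ofReal_re]; linarith
    have h3 : ContinuousAt F l :=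
      Complex.continuous_re.continuousAt.comp
        (ContinuousAt.comp (f := fun x : ℝ => (x : ℂ)) h2 Complex.continuous_ofReal.continuousAt)
    exact h3.tendsto.mono_left nhdsWithin_le_nhds
  have hd := hasDerivAt_chiReal (c := c) H.b_nonneg H.b_lt_one H.h_nonneg hl.le
  have hslope := (hasDerivWithinAt_iff_tendsto_slope' Set.self_notMem_Iio).1
    (hd.hasDerivWithinAt (s := Set.Iio l))
  rw [h1] at hslope
  have hlim : Tendsto (fun x => |slope (chiReal b c (c * τ)) l x| * C
      + |chiReal b c (c * τ) x| * (1 / x)) (𝓝[<] l) (𝓝 (|0| * C + |0| * (1 / l))) := by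
    refine (hslope.abs.mul_const C).add (Tendsto.mul ?_ ?_)
    · have := hd.continuousAt.tendsto.mono_left (nhdsWithin_le_nhds (s := Set.Iio l))
      rw [h0] at this
      exact this.abs
    · exact (tendsto_const_nhds.div tendsto_id hl.ne').mono_left nhdsWithin_le_nhds
  rw [abs_zero, zero_mul, zero_mul, add_zero] at hlim
  refine absurd (le_of_tendsto_of_tendsto hFc hlim ?_) (not_le.2 hFl)
  filter_upwards [Ioo_mem_nhdsLT hl] with x hx
  have hxl : 0 < l - x := by linarith [hx.2]
  have iφ := H.integrable_exp_mul hC hx.1 hx.2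
  have h2 : F x = chiReal b c (c * τ) x * ∫ t, Real.exp (-x * t) * φ t := by
    simp only [hF]
    rw [← H.laplace_identity hC (z := x) hx.1 hx.2, chi0_ofReal, laplace_ofReal,
      ← Complex.ofReal_mul, Complex.ofReal_re]
  have h3 : (∫ t, Real.exp (-x * t) * φ t) ≤ C / (l - x) + 1 / x := by
    rw [← intervalIntegral.integral_Iic_add_Ioi (b := 0) iφ.integrableOn iφ.integrableOn]
    refine add_le_add ?_ ?_
    · have h4 : ∫ t in Set.Iic 0, C * Real.exp ((l - x) * t) = C / (l - x) := by
        rw [integral_const_mul, integral_exp_mul_Iic hxl]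
        simp [div_eq_mul_inv]
      rw [← h4]
      refine integral_mono iφ.integrableOn ((integrableOn_exp_mul_Iic hxl 0).const_mul C)
        fun t => ?_
      simp only
      rw [show (l - x) * t = l * t + -x * t by ring, Real.exp_add]
      have := mul_le_mul_of_nonneg_left (hC t) (Real.exp_pos (-x * t)).le
      linarith
    · have h4 : ∫ t in Set.Ioi 0, Real.exp (-x * t) = 1 / x := by
        rw [integral_exp_mul_Ioi (by linarith [hx.1])]
        simp
      rw [← h4]
      refine integral_mono iφ.integrableOn (integrableOn_exp_mul_Ioi (by linarith [hx.1]) 0)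
        fun t => ?_
      exact mul_le_of_le_one_right (Real.exp_pos _).le (H.le_one t)
  have h5 : 0 ≤ ∫ t, Real.exp (-x * t) * φ t :=
    integral_nonneg fun t => mul_nonneg (Real.exp_pos _).le (H.nonneg t)
  rw [h2]
  calc chiReal b c (c * τ) x * ∫ t, Real.exp (-x * t) * φ t
      ≤ |chiReal b c (c * τ) x| * (C / (l - x) + 1 / x) :=
        mul_le_mul (le_abs_self _) h3 h5 (abs_nonneg _)
    _ = |slope (chiReal b c (c * τ)) l x| * C + |chiReal b c (c * τ) x| * (1 / x) := by
        rw [slope_def_field, h0, sub_zero, abs_div, abs_sub_comm x l, abs_of_pos hxl]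
        ring

end IsMonotoneFront

/-! ### The mode-reducing operator and its inverse. -/

/-- A continuous function that is `O(e^{μ t})` on the whole line for every `0 < μ < l`. -/
def SubexpBound (l : ℝ) (f : ℝ → ℝ) : Prop :=
  Continuous f ∧ ∀ μ, 0 < μ → μ < l → ∃ C, ∀ t, |f t| ≤ C * Real.exp (μ * t)

/-- `f ↦ f - l ∫_{-∞}^t f`, which multiplies the Laplace transform by `(z - l) / z`. -/
noncomputable def reduceMode (l : ℝ) (f : ℝ → ℝ) (t : ℝ) : ℝ :=
  f t - l * ∫ s in Set.Iic t, f s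

theorem integrableOn_Iic_of_exp_bound {f : ℝ → ℝ} (hf : Continuous f) {C μ : ℝ} (hμ : 0 < μ)
    (hC : ∀ t, |f t| ≤ C * Real.exp (μ * t)) (t : ℝ) : IntegrableOn f (Set.Iic t) := by
  simpa using integrableOn_Iic_exp_mul_of_le hf hC hμ t

theorem abs_integral_Iic_le {f : ℝ → ℝ} {C μ : ℝ} (hμ : 0 < μ)
    (hC : ∀ t, |f t| ≤ C * Real.exp (μ * t)) (t : ℝ) :
    |∫ s in Set.Iic t, f s| ≤ C / μ * Real.exp (μ * t) := by
  have h1 : ∫ s in Set.Iic t, C * Real.exp (μ * s) = C / μ * Real.exp (μ * t) := by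
    rw [integral_const_mul, integral_exp_mul_Iic hμ]
    ring
  rw [← h1]
  exact norm_integral_le_of_norm_le ((integrableOn_exp_mul_Iic hμ t).const_mul C)
    (Eventually.of_forall fun s => by rw [Real.norm_eq_abs]; exact hC s)

theorem continuous_integral_Iic {f : ℝ → ℝ} (hf : Continuous f)
    (hi : ∀ t, IntegrableOn f (Set.Iic t)) : Continuous fun t => ∫ s in Set.Iic t, f s :=
  continuous_iff_continuousAt.2 fun t => (hasDerivAt_integral_Iic hf hi t).continuousAt

namespace SubexpBound

variable {l : ℝ} {f : ℝ → ℝ}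

theorem integrableOn_Iic (hl : 0 < l) (hf : SubexpBound l f) (t : ℝ) :
    IntegrableOn f (Set.Iic t) := by
  obtain ⟨C, hC⟩ := hf.2 (l / 2) (by positivity) (by linarith)
  exact integrableOn_Iic_of_exp_bound hf.1 (by positivity) hC t

theorem integral_Iic (hl : 0 < l) (hf : SubexpBound l f) :
    SubexpBound l fun t => ∫ s in Set.Iic t, f s := by
  refine ⟨continuous_integral_Iic hf.1 (hf.integrableOn_Iic hl), fun μ hμ hμl => ?_⟩
  obtain ⟨C, hC⟩ := hf.2 μ hμ hμl
  exact ⟨C / μ, abs_integral_Iic_le hμ hC⟩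

theorem reduceMode (hl : 0 < l) (hf : SubexpBound l f) : SubexpBound l (reduceMode l f) := by
  have hI := hf.integral_Iic hl
  refine ⟨hf.1.sub (hI.1.const_mul l), fun μ hμ hμl => ?_⟩
  obtain ⟨C, hC⟩ := hf.2 μ hμ hμl
  obtain ⟨D, hD⟩ := hI.2 μ hμ hμl
  refine ⟨C + l * D, fun t => (abs_sub _ _).trans ?_⟩
  rw [abs_mul, abs_of_pos hl]
  have := mul_le_mul_of_nonneg_left (hD t) hl.le
  linarith [hC t]

theorem integrable_exp_mul (hf : SubexpBound l f) {x : ℝ} (hx0 : 0 < x) (hxl : x < l) :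
    Integrable fun t => Real.exp (-x * t) * f t := by
  obtain ⟨C, hC⟩ := hf.2 (x / 2) (by positivity) (by linarith)
  obtain ⟨D, hD⟩ := hf.2 ((x + l) / 2) (by linarith) (by linarith)
  exact integrable_exp_mul_of_le hf.1 hC hD (by linarith) (by linarith)

theorem laplace_reduceMode (hl : 0 < l) (hf : SubexpBound l f) {z : ℂ} (hz0 : 0 < z.re)
    (hzl : z.re < l) : laplace (_root_.reduceMode l f) z = (z - l) / z * laplace f z := by
  have hI := hf.integral_Iic hl
  have i1 := hf.integrable_exp_mul hz0 hzl
  have i2 := hI.integrable_exp_mul hz0 hzl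
  have h1 := laplace_deriv (hasDerivAt_integral_Iic hf.1 (hf.integrableOn_Iic hl)) i2 i1
  have h2 : laplace (_root_.reduceMode l f) z
      = laplace f z - l * laplace (fun t => ∫ s in Set.Iic t, f s) z := by
    unfold laplace
    rw [← integral_const_mul, ← integral_sub (integrable_cexp_mul i1)
      ((integrable_cexp_mul i2).const_mul _)]
    congr 1
    funext t
    unfold _root_.reduceMode
    push_cast
    ring
  have hz : z ≠ 0 := by
    rintro rfl
    simp at hz0
  rw [h2, h1]
  field_simp

theorem iterate (hl : 0 < l) (hf : SubexpBound l f) (m : ℕ) :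
    SubexpBound l ((_root_.reduceMode l)^[m] f) := by
  induction m with
  | zero => exact hf
  | succ m ih =>
    rw [Function.iterate_succ_apply']
    exact ih.reduceMode hl

theorem laplace_iterate (hl : 0 < l) (hf : SubexpBound l f) {z : ℂ} (hz0 : 0 < z.re)
    (hzl : z.re < l) (m : ℕ) :
    laplace ((_root_.reduceMode l)^[m] f) z = ((z - l) / z) ^ m * laplace f z := by
  induction m with
  | zero => simp
  | succ m ih =>
    rw [Function.iterate_succ_apply', (hf.iterate hl m).laplace_reduceMode hl hz0 hzl, ih, pow_succ']
    ring

/-- Undoing `reduceMode` integrates the coefficient of `e^{l t}` once. -/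
theorem expansion_of_reduceMode (hl : 0 < l) (hf : SubexpBound l f) {a C x : ℝ} (hx : l < x)
    (hC : ∀ t, |_root_.reduceMode l f t - a * Real.exp (l * t)| ≤ C * Real.exp (x * t)) :
    ∃ B C', ∀ t, |f t - (l * a * t + B) * Real.exp (l * t)| ≤ C' * Real.exp (x * t) := by
  set q : ℝ → ℝ := fun t => ∫ s in Set.Iic t, f s with hq
  have hqd := hasDerivAt_integral_Iic hf.1 (hf.integrableOn_Iic hl)
  set d : ℝ → ℝ := fun t => Real.exp (-l * t) * _root_.reduceMode l f t - a with hd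
  have hw := (hf.reduceMode hl).1
  have hdc : Continuous d := by fun_prop
  have hdb : ∀ t, |d t| ≤ C * Real.exp ((x - l) * t) := by
    intro t
    have h1 : d t = Real.exp (-l * t) * (_root_.reduceMode l f t - a * Real.exp (l * t)) := by
      have : Real.exp (-l * t) * Real.exp (l * t) = 1 := by rw [← Real.exp_add]; simp
      simp only [hd]
      linear_combination a * this
    rw [h1, abs_mul, Real.abs_exp, show (x - l) * t = x * t + -l * t by ring, Real.exp_add]
    have := mul_le_mul_of_nonneg_left (hC t) (Real.exp_pos (-l * t)).le
    linarith
  have hxl : 0 < x - l := by linarith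
  have hdi := integrableOn_Iic_of_exp_bound hdc hxl hdb
  have hJ := abs_integral_Iic_le hxl hdb
  set J : ℝ → ℝ := fun t => ∫ s in Set.Iic t, d s with hJdef
  -- The primitive `q` of `f` satisfies `q' - l q = reduceMode l f`, so `e^{-lt} q` has derivative
  -- `a + d` with `d` exponentially small at `-∞`.
  have hconst : ∀ t, HasDerivAt (fun t => Real.exp (-l * t) * q t - a * t - J t) 0 t := by
    intro t
    have h1 := (((((hasDerivAt_id t).const_mul (-l)).exp).mul (hqd t)).sub
      ((hasDerivAt_id t).const_mul a)).sub (hasDerivAt_integral_Iic hdc hdi t)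
    refine h1.congr_deriv ?_
    simp only [hd, id, _root_.reduceMode]
    ring
  set B₀ := Real.exp (-l * 0) * q 0 - a * 0 - J 0 with hB₀
  have hB : ∀ t, Real.exp (-l * t) * q t - a * t - J t = B₀ := fun t =>
    is_const_of_deriv_eq_zero (fun t => (hconst t).differentiableAt) (fun t => (hconst t).deriv) t 0
  refine ⟨a + l * B₀, C + l * (C / (x - l)), fun t => ?_⟩
  have hE : Real.exp (l * t) * Real.exp (-l * t) = 1 := by rw [← Real.exp_add]; simp
  have h1 : f t - (l * a * t + (a + l * B₀)) * Real.exp (l * t)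
      = (_root_.reduceMode l f t - a * Real.exp (l * t)) + l * (Real.exp (l * t) * J t) := by
    have h2 : q t = Real.exp (l * t) * (B₀ + a * t + J t) := by
      linear_combination Real.exp (l * t) * hB t - q t * hE
    have h3 : _root_.reduceMode l f t = f t - l * q t := rfl
    rw [h3, h2]
    ring
  rw [h1]
  refine (abs_add_le _ _).trans ?_
  rw [abs_mul, abs_mul, Real.abs_exp, abs_of_pos hl]
  have h2 : Real.exp (l * t) * |J t| ≤ C / (x - l) * Real.exp (x * t) := by
    have h3 := mul_le_mul_of_nonneg_left (hJ t) (Real.exp_pos (l * t)).le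
    rw [mul_left_comm, ← Real.exp_add, show l * t + (x - l) * t = x * t by ring] at h3
    exact h3
  have := mul_le_mul_of_nonneg_left h2 hl.le
  linarith [hC t]

end SubexpBound

/-! ### Continuation of the reduced transform across `Re z = l`. -/

namespace IsMonotoneFront

variable {b c τ : ℝ} {φ ψ : ℝ → ℝ}

theorem subexpBound (H : IsMonotoneFront b c (c * τ) φ ψ) {l : ℝ}
    (hpos : ∀ x, 0 ≤ x → x < l → 0 < chiReal b c (c * τ) x) : SubexpBound l φ := by
  refine ⟨H.contDiff.continuous, fun μ hμ hμl => ?_⟩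
  obtain ⟨C, hC⟩ := H.exp_bound_of_chiReal_pos hμ fun x hx => hpos x hx.1 (hx.2.trans_lt hμl)
  exact ⟨C, fun t => by rw [abs_of_nonneg (H.nonneg t)]; exact hC t⟩

/-- If `l` is a zero of order `m` of the characteristic function, alone in a strip, then the
`m`-fold reduction of `φ` decays faster than `e^{l t}`. -/
theorem exp_bound_iterate_reduceMode (H : IsMonotoneFront b c (c * τ) φ ψ) {l ε : ℝ} {m : ℕ}
    (hl : 0 < l) (hφ : SubexpBound l φ) (hord : analyticOrderAt (chi0 b c τ) l = m)
    (hε : 0 < ε) (hstrip : ∀ z : ℂ, |z.re - l| ≤ ε → chi0 b c τ z = 0 → z = l) :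
    ∃ x > l, ∃ C, ∀ t, |(reduceMode l)^[m] φ t| ≤ C * Real.exp (x * t) := by
  -- The rate `3l/4` for `φ` makes `N̂` analytic for `0 < Re z < 3l/2`, which contains the closed
  -- strip as `l + δ ≤ 5l/4`.
  set δ := min ε (l / 4) with hδ
  have hδ0 : 0 < δ := lt_min hε (by positivity)
  have hδε : δ ≤ ε := min_le_left _ _
  have hδl : δ ≤ l / 4 := min_le_right _ _
  obtain ⟨C₀, hC₀'⟩ := hφ.2 (3 * l / 4) (by positivity) (by linarith)
  have hC₀ : ∀ t, φ t ≤ C₀ * Real.exp (3 * l / 4 * t) := fun t => (le_abs_self _).trans (hC₀' t)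
  set N : ℝ → ℝ := fun t => (1 - b) * ψ t * ψ (t - c * τ) with hN
  have hFd := H.differentiableOn_laplace_quadratic (by positivity) hC₀
  have hopen : IsOpen {z : ℂ | 0 < z.re ∧ z.re < 2 * (3 * l / 4)} :=
    (isOpen_lt continuous_const Complex.continuous_re).inter
      (isOpen_lt Complex.continuous_re continuous_const)
  have hFat : ∀ z : ℂ, z.re ∈ Set.Icc (l - δ) (l + δ) → DifferentiableAt ℂ (laplace N) z :=
    fun z hz => hFd.differentiableAt (hopen.mem_nhds ⟨by linarith [hz.1], by linarith [hz.2]⟩)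
  have hre : ∀ z : ℂ, z.re ∈ Set.Icc (l - δ) (l + δ) → 0 < z.re := fun z hz => by linarith [hz.1]
  have hne : ∀ z : ℂ, z.re ∈ Set.Icc (l - δ) (l + δ) → z ≠ 0 := fun z hz h0 => by
    have := hre z hz
    rw [h0] at this
    simp at this
  have hchi : ∀ z : ℂ, z.re ∈ Set.Icc (l - δ) (l + δ) → z ≠ l → chi0 b c τ z ≠ 0 :=
    fun z hz hzl h0 => hzl (hstrip z (_root_.abs_le.2 ⟨by linarith [hz.1], by linarith [hz.2]⟩) h0)
  have hlmem : (l : ℂ).re ∈ Set.Icc (l - δ) (l + δ) := by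
    simp only [Complex.ofReal_re]
    exact ⟨by linarith, by linarith⟩
  obtain ⟨g, hga, hg0, hg⟩ := (analyticAt_chi0 H.b_nonneg H.b_lt_one H.h_nonneg
    (z := (l : ℂ)) hl).analyticOrderAt_eq_natCast.1 hord
  -- The value at `l` removes the singularity: near `l`, `χ₀ = (z - l)^m g` with `g(l) ≠ 0`.
  set G : ℂ → ℂ := Function.update
    (fun z => laplace N z * ((z - l) / z) ^ m / chi0 b c τ z) l
    (laplace N l / ((l : ℂ) ^ m * g l)) with hG
  have hGne : ∀ z : ℂ, z ≠ l → G z = laplace N z * ((z - l) / z) ^ m / chi0 b c τ z :=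
    fun z hz => Function.update_of_ne hz _ _
  have hGd : DifferentiableOn ℂ G (Complex.re ⁻¹' Set.Icc (l - δ) (l + δ)) := by
    intro z hz
    refine DifferentiableAt.differentiableWithinAt ?_
    rcases eq_or_ne z l with rfl | hzl
    · have h1 : G =ᶠ[𝓝 (l : ℂ)] fun z => laplace N z / (z ^ m * g z) := by
        have hlc : (l : ℂ) ≠ 0 := hne _ hlmem
        filter_upwards [hg, hga.continuousAt.eventually_ne hg0,
          continuousAt_id.eventually_ne hlc] with w hw hgw hw0
        simp only [id] at hw0
        rcases eq_or_ne w l with rfl | hwl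
        · exact Function.update_self _ _ _
        · rw [hGne w hwl, hw, smul_eq_mul, div_pow]
          have : w - l ≠ 0 := sub_ne_zero.2 hwl
          field_simp
      refine DifferentiableAt.congr_of_eventuallyEq ?_ h1
      refine (hFat _ hlmem).div ((differentiableAt_id.pow m).mul hga.differentiableAt) ?_
      exact mul_ne_zero (pow_ne_zero _ (hne _ hlmem)) hg0
    · have h1 : G =ᶠ[𝓝 z] fun z => laplace N z * ((z - l) / z) ^ m / chi0 b c τ z := by
        filter_upwards [continuousAt_id.eventually_ne hzl] with w hw
        exact hGne w hw
      refine DifferentiableAt.congr_of_eventuallyEq ?_ h1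
      refine ((hFat z hz).mul (((differentiableAt_id.sub_const _).div differentiableAt_id
        (hne z hz)).pow m)).div
        (hasDerivAt_chi0 H.b_nonneg H.b_lt_one H.h_nonneg (hre z hz).le).differentiableAt
        (hchi z hz hzl)
  set A := ∫ t, (Real.exp (-(l - δ) * t) * |N t| + Real.exp (-(l + δ) * t) * |N t|) with hA
  have iN : ∀ x, 0 < x → x < 2 * (3 * l / 4) → Integrable fun t => Real.exp (-x * t) * |N t| :=
    fun x h1 h2 => by
      have h3 := H.integrable_exp_mul_quadratic hC₀ h1 h2
      refine h3.congr (Eventually.of_forall fun t => ?_)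
      simp only [hN, abs_of_pos (H.quadratic_pos t)]
  have hFb : ∀ z : ℂ, z.re ∈ Set.Icc (l - δ) (l + δ) → ‖laplace N z‖ ≤ A := by
    intro z hz
    refine (norm_laplace_le z).trans (integral_mono (iN _ (hre z hz) (by linarith [hz.2]))
      ((iN _ (by linarith) (by linarith)).add (iN _ (by linarith) (by linarith))) fun t => ?_)
    simp only
    rw [← add_mul]
    refine mul_le_mul_of_nonneg_right ?_ (abs_nonneg _)
    rcases le_total 0 t with ht | ht
    · have : Real.exp (-z.re * t) ≤ Real.exp (-(l - δ) * t) :=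
        Real.exp_le_exp.2 (mul_le_mul_of_nonneg_right (by linarith [hz.1]) ht)
      linarith [Real.exp_pos (-(l + δ) * t)]
    · have : Real.exp (-z.re * t) ≤ Real.exp (-(l + δ) * t) :=
        Real.exp_le_exp.2 (mul_le_mul_of_nonpos_right (by linarith [hz.2]) ht)
      linarith [Real.exp_pos (-(l - δ) * t)]
  have hA0 : 0 ≤ A := (norm_nonneg _).trans (hFb l hlmem)
  have hquot : ∀ z : ℂ, z.re ∈ Set.Icc (l - δ) (l + δ) → ‖((z - l) / z) ^ m‖ ≤ 3 ^ m := by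
    intro z hz
    rw [norm_pow]
    refine pow_le_pow_left₀ (norm_nonneg _) ?_ m
    rw [norm_div, div_le_iff₀ (norm_pos_iff.2 (hne z hz))]
    refine (norm_sub_le _ _).trans ?_
    rw [Complex.norm_real, Real.norm_of_nonneg hl.le]
    have h1 : z.re ≤ ‖z‖ := (le_abs_self _).trans (Complex.abs_re_le_norm z)
    linarith [hz.1]
  set k := (1 - b)⁻¹ with hk
  have hk0 : 0 < k := inv_pos.2 H.one_sub_b_pos
  -- Beyond this height `le_norm_chi0` yields `|χ₀| ≥ (1 + (Im z)²) / 2`; below it compactness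
  -- bounds `G`.
  set M := Real.sqrt (2 * k + 1) with hM
  have hMsq : M ^ 2 = 2 * k + 1 := Real.sq_sqrt (by positivity)
  have hRc : IsCompact (Set.Icc (l - δ) (l + δ) ×ℂ Set.Icc (-M) M) :=
    isCompact_Icc.reProdIm isCompact_Icc
  obtain ⟨D, hD⟩ := hRc.exists_bound_of_continuousOn
    (hGd.continuousOn.mono fun z hz => (Complex.mem_reProdIm.1 hz).1)
  have hGb : ∀ z : ℂ, z.re ∈ Set.Icc (l - δ) (l + δ) →
      ‖G z‖ ≤ max (D * (1 + M ^ 2)) (2 * (A * 3 ^ m)) * (1 + z.im ^ 2)⁻¹ := by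
    intro z hz
    have hpos : 0 < 1 + z.im ^ 2 := by positivity
    rw [← div_eq_mul_inv, le_div_iff₀ hpos]
    by_cases him : |z.im| ≤ M
    · have h1 := hD z (Complex.mem_reProdIm.2 ⟨hz, _root_.abs_le.1 him⟩)
      have h2 : z.im ^ 2 ≤ M ^ 2 := sq_le_sq' (_root_.abs_le.1 him).1 (_root_.abs_le.1 him).2
      refine le_max_of_le_left (mul_le_mul h1 (by linarith) hpos.le ((norm_nonneg _).trans h1))
    · push Not at him
      have h2 : 2 * k + 1 < z.im ^ 2 := by
        rw [← hMsq, ← sq_abs z.im]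
        exact pow_lt_pow_left₀ him (Real.sqrt_nonneg _) two_ne_zero
      have hzl : z ≠ l := by
        rintro rfl
        simp only [Complex.ofReal_im] at h2
        linarith
      have h3 := le_norm_chi0 H.b_nonneg H.b_lt_one H.h_nonneg (hre z hz).le
      have h4 : (1 + z.im ^ 2) / 2 ≤ ‖chi0 b c τ z‖ := by linarith
      have h5 : 0 < ‖chi0 b c τ z‖ := lt_of_lt_of_le (by positivity) h4
      refine le_max_of_le_right ?_
      rw [hGne z hzl, norm_div, norm_mul, div_mul_eq_mul_div, div_le_iff₀ h5]
      have h6 := mul_le_mul (hFb z hz) (hquot z hz) (norm_nonneg _) hA0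
      have h7 : 0 ≤ A * 3 ^ m := by positivity
      calc _ ≤ A * 3 ^ m * (1 + z.im ^ 2) := mul_le_mul_of_nonneg_right h6 hpos.le
        _ ≤ A * 3 ^ m * (2 * ‖chi0 b c τ z‖) := mul_le_mul_of_nonneg_left (by linarith) h7
        _ = _ := by ring
  refine ⟨l + δ, by linarith, ?_⟩
  have hx0 : 0 < l - δ := by linarith
  refine exp_bound_of_laplace_continuation (hφ.iterate hl m).1 (by linarith)
    ((hφ.iterate hl m).integrable_exp_mul hx0 (by linarith)) hGd hGb fun y => ?_
  set z : ℂ := ((l - δ : ℝ) : ℂ) + y * Complex.I with hz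
  have hzre : z.re = l - δ := by simp [hz]
  have hzmem : z.re ∈ Set.Icc (l - δ) (l + δ) := by rw [hzre]; exact ⟨le_rfl, by linarith⟩
  have hzl : z ≠ l := by
    intro h1
    rw [h1] at hzre
    simp only [Complex.ofReal_re] at hzre
    linarith
  obtain ⟨C₁, hC₁⟩ := hφ.2 (l - δ / 2) (by linarith) (by linarith)
  rw [hφ.laplace_iterate hl (hre z hzmem) (by rw [hzre]; linarith), hGne z hzl,
    ← H.laplace_identity (fun t => (le_abs_self _).trans (hC₁ t)) (hre z hzmem)
      (by rw [hzre]; linarith)]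
  have := hchi z hzmem hzl
  field_simp

end IsMonotoneFront

/-! ### Normalisation by translation and signs of the leading coefficients. -/

theorem tendsto_const_mul_exp_atBot (C : ℝ) {δ : ℝ} (hδ : 0 < δ) :
    Tendsto (fun t => C * Real.exp (δ * t)) atBot (𝓝 0) := by
  have h1 : Tendsto (fun t => C * Real.exp (δ * t)) atBot (𝓝 (C * 0)) :=
    (Real.tendsto_exp_atBot.comp (tendsto_id.const_mul_atBot hδ)).const_mul C
  rwa [mul_zero] at h1

theorem isLittleO_exp_atBot {r : ℝ → ℝ} {C δ : ℝ} (hδ : 0 < δ)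
    (hr : ∀ t, |r t| ≤ C * Real.exp (δ * t)) :
    r =o[atBot] fun t => Real.exp (δ / 2 * t) := by
  have h1 : r =O[atBot] fun t => Real.exp (δ * t) :=
    IsBigO.of_bound C (Eventually.of_forall fun t => by
      rw [Real.norm_eq_abs, Real.norm_eq_abs, Real.abs_exp]; exact hr t)
  refine h1.trans_isLittleO ((isLittleO_iff_tendsto fun t ht => absurd ht (Real.exp_ne_zero _)).2 ?_)
  refine (tendsto_const_mul_exp_atBot 1 (half_pos hδ)).congr fun t => ?_
  rw [← Real.exp_sub, one_mul]
  congr 1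
  ring

/-- A translation normalises the leading coefficient `K > 0` of an expansion at `-∞`. -/
theorem exists_translate_expansion {φ : ℝ → ℝ} {l x K B C : ℝ} {j : ℕ} (hl : 0 < l) (hx : l < x)
    (hK : 0 < K) (hj : j = 0 ∧ K = B ∨ j = 1)
    (hC : ∀ t, |φ t - (-(j * K) * t + B) * Real.exp (l * t)| ≤ C * Real.exp (x * t)) :
    ∃ ε : ℝ, 0 < ε ∧ ∃ (tₐ d : ℝ) (r : ℝ → ℝ), r =o[atBot] (fun t : ℝ => Real.exp (ε * t)) ∧
      ∀ t : ℝ, φ (t + tₐ) = Real.exp (l * t) * ((-t) ^ j + j * d + r t) := by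
  -- The translation is fixed by `K e^{ls} = 1`. For `j = 1` it also moves the constant term to `B /
  -- K - s`; for `j = 0` the value of `d` is irrelevant.
  set s := -Real.log K / l with hs
  have hKs : K * Real.exp (l * s) = 1 := by
    have : l * s = -Real.log K := by rw [hs]; field_simp
    rw [this, Real.exp_neg, Real.exp_log hK, mul_inv_cancel₀ hK.ne']
  have hxl : 0 < x - l := by linarith
  set d := B / K - s with hd
  set r : ℝ → ℝ := fun t => Real.exp (-l * t) * φ (t + s) - ((-t) ^ j + j * d) with hr
  have hE : ∀ t, Real.exp (l * t) * Real.exp (-l * t) = 1 := fun t => by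
    rw [← Real.exp_add]; simp
  refine ⟨(x - l) / 2, half_pos hxl, s, d, r, isLittleO_exp_atBot hxl
    (C := C * Real.exp (x * s)) fun t => ?_, fun t => ?_⟩
  · have h1 : r t = Real.exp (-l * t) *
        (φ (t + s) - (-(j * K) * (t + s) + B) * Real.exp (l * (t + s))) := by
      have h2 : (-t) ^ j + j * d = (-(j * K) * (t + s) + B) * Real.exp (l * s) := by
        rcases hj with ⟨rfl, rfl⟩ | rfl
        · simp [hKs]
        · have hB : B = K * (B / K) := by field_simp
          simp only [pow_one, Nat.cast_one, one_mul, hd]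
          linear_combination (t + s - B / K) * hKs - Real.exp (l * s) * hB
      simp only [hr]
      rw [h2, mul_add l, Real.exp_add]
      linear_combination (-(j * K) * (t + s) + B) * Real.exp (l * s) * hE t
    rw [h1, abs_mul, Real.abs_exp]
    refine (mul_le_mul_of_nonneg_left (hC (t + s)) (Real.exp_pos _).le).trans (le_of_eq ?_)
    rw [show (x - l) * t = -l * t + x * t by ring, mul_add x, Real.exp_add, Real.exp_add]
    ring
  · simp only [hr]
    linear_combination (-φ (t + s)) * hE t

namespace IsMonotoneFront

variable {b c τ : ℝ} {φ ψ : ℝ → ℝ}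

theorem le_exp_of_expansion (H : IsMonotoneFront b c (c * τ) φ ψ) {l x B C : ℝ} (hl : 0 < l)
    (hx : l < x) (hC : ∀ t, |φ t - B * Real.exp (l * t)| ≤ C * Real.exp (x * t)) :
    ∃ C', ∀ t, φ t ≤ C' * Real.exp (l * t) := by
  refine ⟨max (|B| + |C|) 1, fun t => ?_⟩
  rcases le_total t 0 with ht | ht
  · have h1 := (abs_sub_le_iff.1 (hC t)).1
    have h2 : Real.exp (x * t) ≤ Real.exp (l * t) := Real.exp_le_exp.2 (by nlinarith)
    have h3 : C * Real.exp (x * t) ≤ |C| * Real.exp (l * t) :=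
      mul_le_mul (le_abs_self C) h2 (Real.exp_pos _).le (abs_nonneg _)
    have h4 : B * Real.exp (l * t) ≤ |B| * Real.exp (l * t) :=
      mul_le_mul_of_nonneg_right (le_abs_self B) (Real.exp_pos _).le
    have h5 : (|B| + |C|) * Real.exp (l * t) ≤ max (|B| + |C|) 1 * Real.exp (l * t) :=
      mul_le_mul_of_nonneg_right (le_max_left _ _) (Real.exp_pos _).le
    linarith
  · exact (H.le_one t).trans
      (one_le_mul_of_one_le_of_one_le (le_max_right _ _) (Real.one_le_exp (by positivity)))

/-- If `B = 0`, `φ` would decay faster than `not_exp_bound` allows; the sign comes from `φ ≥ 0`. -/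
theorem expansion_coeff_pos (H : IsMonotoneFront b c (c * τ) φ ψ) {l x B C : ℝ} (hl : 0 < l)
    (h0 : chiReal b c (c * τ) l = 0) (hx : l < x)
    (hC : ∀ t, |φ t - B * Real.exp (l * t)| ≤ C * Real.exp (x * t)) : 0 < B := by
  have hB : B ≠ 0 := by
    rintro rfl
    refine H.not_exp_bound hl h0 hx (C := C) fun t => ?_
    have := hC t
    rw [zero_mul, sub_zero] at this
    exact (le_abs_self _).trans this
  refine lt_of_le_of_ne ?_ hB.symm
  have h1 := tendsto_const_mul_exp_atBot (-C) (sub_pos.2 hx)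
  refine le_of_tendsto' h1 fun t => ?_
  have h2 := (abs_sub_le_iff.1 (hC t)).1
  have h3 := H.nonneg t
  have h4 : Real.exp (x * t) = Real.exp ((x - l) * t) * Real.exp (l * t) := by
    rw [← Real.exp_add]; congr 1; ring
  rw [h4] at h2
  have h5 : (-C * Real.exp ((x - l) * t)) * Real.exp (l * t) ≤ B * Real.exp (l * t) := by linarith
  exact le_of_mul_le_mul_right h5 (Real.exp_pos _)

/-- If `A = 0`, `φ = O(e^{lt})`, excluded at a double zero; if `A > 0`, `φ` would be negative near
`-∞`. -/
theorem expansion_coeff_neg (H : IsMonotoneFront b c (c * τ) φ ψ) {l x A B C : ℝ} (hl : 0 < l)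
    (h0 : chiReal b c (c * τ) l = 0) (h1 : chiRealDeriv b c (c * τ) l = 0) (hx : l < x)
    (hC : ∀ t, |φ t - (A * t + B) * Real.exp (l * t)| ≤ C * Real.exp (x * t)) : A < 0 := by
  have hA : A ≠ 0 := by
    rintro rfl
    simp only [zero_mul, zero_add] at hC
    obtain ⟨C', hC'⟩ := H.le_exp_of_expansion hl hx hC
    exact H.not_exp_bound_of_double hl h0 h1 hC'
  by_contra! hA0
  have hpos : 0 < A := lt_of_le_of_ne hA0 hA.symm
  have hlim : Tendsto (fun t => A * t + (B + |C|)) atBot atBot :=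
    tendsto_atBot_add_const_right _ _ (tendsto_id.const_mul_atBot hpos)
  obtain ⟨t, ht, ht0⟩ := ((hlim.eventually (eventually_lt_atBot 0)).and (eventually_le_atBot 0)).exists
  have h2 := (abs_sub_le_iff.1 (hC t)).1
  have h3 := H.nonneg t
  have h4 : Real.exp (x * t) ≤ Real.exp (l * t) := Real.exp_le_exp.2 (by nlinarith)
  have h5 : C * Real.exp (x * t) ≤ |C| * Real.exp (l * t) :=
    mul_le_mul (le_abs_self C) h4 (Real.exp_pos _).le (abs_nonneg _)
  have h6 := mul_neg_of_neg_of_pos ht (Real.exp_pos (l * t))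
  linarith

end IsMonotoneFront

/-! ### Assembly: simple and double leading zero. -/

theorem lemma2p4 (b c τ : ℝ) (hb0 : 0 ≤ b) (hb1 : b < 1) (hc : 0 < c) (hτ : 0 ≤ τ)
    (φ : ℝ → ℝ) (hφ : IsProfileSolution b c τ φ)
    (hmono : Monotone φ ∨ Antitone φ)
    (hbdd : ∃ M : ℝ, ∀ t : ℝ, |φ t| ≤ M)
    (hnonconst : ¬ ∃ k : ℝ, ∀ t : ℝ, φ t = k) :
    (∀ t : ℝ, 0 < deriv φ t) ∧
    ∃ l₂ l₁ : ℝ, 0 < l₂ ∧ l₂ ≤ l₁ ∧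
      -- the positive zeros of `χ₀`, counted with multiplicity, are exactly `l₂` and `l₁`
      (∀ x : ℝ, 0 < x →
        analyticOrderAt (chi0 b c τ) (x : ℂ)
          = (if x = l₂ then 1 else 0) + (if x = l₁ then 1 else 0)) ∧
      ∃ j : ℕ, (l₂ < l₁ → j = 0) ∧ (l₂ = l₁ → j = 1) ∧
        ∃ ε : ℝ, 0 < ε ∧ ∃ (tₐ d : ℝ) (r : ℝ → ℝ),
          r =o[atBot] (fun t : ℝ => Real.exp (ε * t)) ∧
          ∀ t : ℝ, φ (t + tₐ) = Real.exp (l₂ * t) * ((-t) ^ j + j * d + r t) := by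
  have hmono' : Monotone φ := hmono.resolve_right fun hanti => by
    have h1 := hanti.ge_of_tendsto hφ.tendsto_atBot 0
    have h2 := hanti.le_of_tendsto hφ.tendsto_atTop 0
    linarith
  have H := hφ.isMonotoneFront hb0 hb1 hc hτ hmono'
  have hh := H.h_nonneg
  obtain ⟨l₂, l₁, hl, hle, -, hpos, hz₂, hz₁, honly, hsimple, hdouble⟩ :=
    exists_zeros_chiReal hb0 hb1 hh H.exists_chiReal_nonpos
  have hφs := H.subexpBound hpos
  refine ⟨H.deriv_pos, l₂, l₁, hl, hle, fun x hx => ?_, ?_⟩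
  · by_cases hx0 : chiReal b c (c * τ) x = 0
    · rcases hle.eq_or_lt with heq | hlt
      · obtain rfl : x = l₂ := (honly x hx hx0).elim id fun h => h.trans heq.symm
        rw [analyticOrderAt_chi0_of_deriv_eq_zero hb0 hb1 hh hx hx0 (hdouble heq), if_pos rfl,
          if_pos heq]
        norm_num
      · obtain ⟨hd₂, hd₁⟩ := hsimple hlt
        rcases honly x hx hx0 with rfl | rfl
        · rw [analyticOrderAt_chi0_of_deriv_ne_zero hb0 hb1 hh hx hx0 hd₂.ne, if_pos rfl,
            if_neg hlt.ne, add_zero]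
        · rw [analyticOrderAt_chi0_of_deriv_ne_zero hb0 hb1 hh hx hx0 hd₁.ne', if_pos rfl,
            if_neg hlt.ne', zero_add]
    · rw [if_neg (by rintro rfl; exact hx0 hz₂), if_neg (by rintro rfl; exact hx0 hz₁), add_zero,
        (analyticAt_chi0 hb0 hb1 hh (z := (x : ℂ)) hx).analyticOrderAt_eq_zero, chi0_ofReal]
      exact_mod_cast hx0
  · rcases hle.eq_or_lt with heq | hlt
    · have hd := hdouble heq
      have hord := analyticOrderAt_chi0_of_deriv_eq_zero hb0 hb1 hh hl hz₂ hd
      obtain ⟨ε, hε, -, hstrip⟩ := exists_zero_free_strip hb0 hb1 hh hl hz₂ (by rw [hord]; decide)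
      obtain ⟨x, hx, C, hC⟩ := H.exp_bound_iterate_reduceMode (m := 2) hl hφs hord hε hstrip
      -- The twice reduced function has no `e^{lt}` mode (`a = 0`). The first inversion creates the
      -- coefficient `B₁`, and the second the linear factor `l₂ B₁ t + B`.
      obtain ⟨B₁, C₁, h₁⟩ := (hφs.reduceMode hl).expansion_of_reduceMode hl (a := 0) (C := C) hx
        fun t => by simpa using hC t
      obtain ⟨B, C₂, h₂⟩ := hφs.expansion_of_reduceMode hl (a := B₁) (C := C₁) hx
        fun t => by simpa using h₁ t
      have hneg := H.expansion_coeff_neg hl hz₂ hd hx h₂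
      refine ⟨1, fun h => absurd heq h.ne, fun _ => rfl, ?_⟩
      exact exists_translate_expansion (K := -(l₂ * B₁)) (B := B) (C := C₂) hl hx (by linarith)
        (Or.inr rfl) fun t => by simpa using h₂ t
    · have hd := (hsimple hlt).1
      have hord := analyticOrderAt_chi0_of_deriv_ne_zero hb0 hb1 hh hl hz₂ hd.ne
      obtain ⟨ε, hε, -, hstrip⟩ := exists_zero_free_strip hb0 hb1 hh hl hz₂ (by rw [hord]; decide)
      obtain ⟨x, hx, C, hC⟩ := H.exp_bound_iterate_reduceMode (m := 1) hl hφs hord hε hstrip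
      obtain ⟨B, C₁, h₁⟩ := hφs.expansion_of_reduceMode hl (a := 0) (C := C) hx
        fun t => by simpa using hC t
      have h₁' : ∀ t, |φ t - B * Real.exp (l₂ * t)| ≤ C₁ * Real.exp (x * t) := fun t => by
        simpa using h₁ t
      have hB := H.expansion_coeff_pos hl hz₂ hx h₁'
      refine ⟨0, fun _ => rfl, fun h => absurd h hlt.ne, ?_⟩
      exact exists_translate_expansion (K := B) (B := B) (C := C₁) hl hx hB (Or.inl ⟨rfl, rfl⟩)
        fun t => by simpa using h₁' t
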